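/- Let $(\mathbb F_1,\mathbb F_2)$ be one of $(\mathbb R,\mathbb R)$, $(\mathbb C,\mathbb C)$, $(\mathbb C,\mathbb R)$, and let $G$ be a discrete group. An $\mathbb F_1$-operator space is an $\mathbb F_1$-linear subspace $X\subseteq B(\mathcal H)$ for a Hilbert space $\mathcal H$ over $\mathbb F_1$; it is unital if it contains the identity operator, and an operator system if it is moreover closed under adjoints. $M_n(X)$ carries the norm and the positive elements of $B(\mathcal H^n)$. Let $\mathsf{OSp}_{(\mathbb F_1,\mathbb F_2)}$ (resp. $\mathsf{OSp}^{\mathbb 1}_{(\mathbb F_1,\mathbb F_2)}$, $\mathsf{OSy}_{(\mathbb F_1,\mathbb F_2)}$) be the category of $\mathbb F_1$-operator spaces (resp. unital $\mathbb F_1$-operator spaces, $\mathbb F_1$-operator systems) whose morphisms are the completely contractive (resp. unital completely contractive, unital completely positive) $\mathbb F_2$-linear maps. The categories $\mathsf{OSp}^{G}_{(\mathbb F_1,\mathbb F_2)}$, $\mathsf{OSp}^{\mathbb 1,G}_{(\mathbb F_1,\mathbb F_2)}$, $\mathsf{OSy}^{G}_{(\mathbb F_1,\mathbb F_2)}$ have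 as objects such spaces with an action of $G$ by $\mathbb F_1$-linear surjective complete isometries (resp. unital surjective complete isometries, unital complete order isomorphisms), and as morphisms the $G$-equivariant ones. An object $Z$ of one of these six categories is injective if for all objects $A,B$, every $\mathbb F_2$-linear (and, in the $G$-categories, $G$-equivariant; for unital spaces and systems, unital) complete isometry $\kappa:A\to B$ and every morphism $\varphi:A\to Z$ there is a morphism $\tilde\varphi:B\to Z$ with $\tilde\varphi\circ\kappa=\varphi$ and $\|\tilde\varphi\|_{cb}=\|\varphi\|_{cb}$. Let $X\subseteq B(\mathcal H)$ be an object of $\mathsf{OSp}^{G}_{(\mathbb F_1,\mathbb F_2)}$ (resp. $\mathsf{OSp}^{\mathbb 1,G}_{(\mathbb F_1,\mathbb F_2)}$, $\mathsf{OSy}^{G}_{(\mathbb F_1,\mathbb F_2)}$). Let $\ell^\infty(G,X)$ be the space of bounded functions $G\to X$, regarded as diagonal operators on $\ell^2(G,\mathcal H)$, with the action $(tf)(s)=f(t^{-1}s)$, and let $j:X\to\ell^\infty(G,X)$, $j(x)(s)=s^{-1}x$. Then $X$ is injective in $\mathsf{OSp}^{G}_{(\mathbb F_1,\mathbb F_2)}$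 (resp. $\mathsf{OSp}^{\mathbb 1,G}_{(\mathbb F_1,\mathbb F_2)}$, $\mathsf{OSy}^{G}_{(\mathbb F_1,\mathbb F_2)}$) if and only if 1. $X$ is injective in $\mathsf{OSp}_{(\mathbb F_1,\mathbb F_2)}$ (resp. $\mathsf{OSp}^{\mathbb 1}_{(\mathbb F_1,\mathbb F_2)}$, $\mathsf{OSy}_{(\mathbb F_1,\mathbb F_2)}$), and 2. there is a $G$-equivariant completely contractive (resp. unital completely contractive, unital completely positive) $\mathbb F_2$-linear idempotent map $\phi:\ell^\infty(G,X)\to\ell^\infty(G,X)$ with range $j(X)$ and $\phi\circ j=j$ (that is, $\phi\circ j=\mathrm{Id}_X$ once $X$ is identified with $j(X)$ through $j$). -/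

import Mathlib

noncomputable section

namespace OpSp

open scoped ENNReal

universe u

/-! ### Matrices of operators -/

section Matrices

variable {𝕜 : Type} [RCLike 𝕜] {H : Type u} [NormedAddCommGroup H] [InnerProductSpace 𝕜 H]

/-- The operator on the Hilbert space `Hⁿ` given by an `n × n` matrix of operators on `H`. -/
def matOp {n : ℕ} (a : Matrix (Fin n) (Fin n) (H →L[𝕜] H)) :
    PiLp 2 (fun _ : Fin n => H) →L[𝕜] PiLp 2 (fun _ : Fin n => H) :=
  (PiLp.continuousLinearEquiv 2 𝕜 (fun _ : Fin n => H)).symm.toContinuousLinearMap ∘L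
    ContinuousLinearMap.pi (fun i => ∑ j, (a i j) ∘L PiLp.proj 2 (fun _ : Fin n => H) j)

theorem matOp_apply {n : ℕ} (a : Matrix (Fin n) (Fin n) (H →L[𝕜] H))
    (v : PiLp 2 (fun _ : Fin n => H)) (i : Fin n) : matOp a v i = ∑ j, a i j (v j) := by
  simp [matOp]

end Matrices

/-- A `𝕜`-operator space: a `𝕜`-vector space `V` identified, through an injective linear map, with
a linear subspace of `B(H)` for a Hilbert space `H` over `𝕜`. -/
structure OperatorSpace (𝕜 : Type) [RCLike 𝕜] where
  V : Type u
  [addCommGroup : AddCommGroup V]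
  [module : Module 𝕜 V]
  H : Type u
  [normedAddCommGroup : NormedAddCommGroup H]
  [innerProductSpace : InnerProductSpace 𝕜 H]
  [completeSpace : CompleteSpace H]
  toOp : V →ₗ[𝕜] (H →L[𝕜] H)
  toOp_injective : Function.Injective toOp

attribute [instance] OperatorSpace.addCommGroup OperatorSpace.module
  OperatorSpace.normedAddCommGroup OperatorSpace.innerProductSpace OperatorSpace.completeSpace

namespace OperatorSpace

variable {𝕜 : Type} [RCLike 𝕜]

/-- The operator on `Hⁿ` represented by an element of `Mₙ(X)`. -/
def mat (X : OperatorSpace.{u} 𝕜) {n : ℕ} (a : Matrix (Fin n) (Fin n) X.V) :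
    PiLp 2 (fun _ : Fin n => X.H) →L[𝕜] PiLp 2 (fun _ : Fin n => X.H) :=
  matOp (a.map X.toOp)

/-- The norm of `Mₙ(X)`. -/
def matNorm (X : OperatorSpace.{u} 𝕜) {n : ℕ} (a : Matrix (Fin n) (Fin n) X.V) : ℝ := ‖X.mat a‖

/-- The positive elements of `Mₙ(X)` (positivity includes self-adjointness). -/
def MatPos (X : OperatorSpace.{u} 𝕜) {n : ℕ} (a : Matrix (Fin n) (Fin n) X.V) : Prop :=
  (X.mat a).IsPositive

/-- `X` contains the identity operator. -/
def IsUnital (X : OperatorSpace.{u} 𝕜) : Prop := ∃ x : X.V, X.toOp x = 1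

/-- `X` is an operator system: unital and closed under taking adjoints. -/
def IsSystem (X : OperatorSpace.{u} 𝕜) : Prop :=
  X.IsUnital ∧ ∀ x : X.V, ∃ y : X.V, X.toOp y = star (X.toOp x)

end OperatorSpace

/-! ### Maps between operator spaces -/

section Maps

variable {𝕜 : Type} [RCLike 𝕜] {X Y : OperatorSpace.{u} 𝕜}

/-- Linearity over a field `F₂` of scalars contained in `𝕜`. -/
structure IsLinearOver (F₂ : Type) [RCLike F₂] [NormedAlgebra F₂ 𝕜] (T : X.V → Y.V) : Prop where
  map_add : ∀ x y, T (x + y) = T x + T y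
  map_smul : ∀ (c : F₂) (x), T (algebraMap F₂ 𝕜 c • x) = algebraMap F₂ 𝕜 c • T x

/-- `T` maps the identity to the identity. -/
def MapsUnit (T : X.V → Y.V) : Prop := ∀ x, X.toOp x = 1 → Y.toOp (T x) = 1

/-- All amplifications `Tₙ : Mₙ(X) → Mₙ(Y)` are contractive. -/
def CompletelyContractive (T : X.V → Y.V) : Prop :=
  ∀ (n : ℕ) (a : Matrix (Fin n) (Fin n) X.V), Y.matNorm (a.map T) ≤ X.matNorm a

/-- All amplifications `Tₙ : Mₙ(X) → Mₙ(Y)` are isometric. -/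
def CompletelyIsometric (T : X.V → Y.V) : Prop :=
  ∀ (n : ℕ) (a : Matrix (Fin n) (Fin n) X.V), Y.matNorm (a.map T) = X.matNorm a

/-- All amplifications `Tₙ : Mₙ(X) → Mₙ(Y)` preserve positivity. -/
def CompletelyPositive (T : X.V → Y.V) : Prop :=
  ∀ (n : ℕ) (a : Matrix (Fin n) (Fin n) X.V), X.MatPos a → Y.MatPos (a.map T)

/-- All amplifications `Tₙ : Mₙ(X) → Mₙ(Y)` preserve and reflect positivity. -/
def CompleteOrderEmbedding (T : X.V → Y.V) : Prop :=
  ∀ (n : ℕ) (a : Matrix (Fin n) (Fin n) X.V), X.MatPos a ↔ Y.MatPos (a.map T)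

/-- The completely bounded norm of `T`, the supremum over `n` of the norms of the maps `Tₙ`. -/
def cbNorm (T : X.V → Y.V) : ℝ≥0∞ :=
  ⨆ (n : ℕ) (a : Matrix (Fin n) (Fin n) X.V) (_ : X.matNorm a ≤ 1),
    ENNReal.ofReal (Y.matNorm (a.map T))

/-- `T` intertwines the actions `ρ` and `σ` of `G`. -/
def IsEquivariant {G : Type u} [Group G] (ρ : Representation 𝕜 G X.V) (σ : Representation 𝕜 G Y.V)
    (T : X.V → Y.V) : Prop := ∀ g x, T (ρ g x) = σ g (T x)

end Maps

/-! ### The categories -/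

/-- The three kinds of categories: operator spaces, unital operator spaces, operator systems. -/
inductive Kind
  | OSp
  | OSp1
  | OSy

namespace Kind

variable {𝕜 : Type} [RCLike 𝕜]

/-- The objects of the category of the given kind. -/
def IsObject : Kind → OperatorSpace.{u} 𝕜 → Prop
  | OSp, _ => True
  | OSp1, X => X.IsUnital
  | OSy, X => X.IsSystem

/-- The `F₂`-linear morphisms: completely contractive, unital completely contractive, and unital
completely positive maps. -/
def IsMorphism (k : Kind) (F₂ : Type) [RCLike F₂] [NormedAlgebra F₂ 𝕜]
    {X Y : OperatorSpace.{u} 𝕜} (T : X.V → Y.V) : Prop :=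
  IsLinearOver F₂ T ∧
    match k with
    | OSp => CompletelyContractive T
    | OSp1 => MapsUnit T ∧ CompletelyContractive T
    | OSy => MapsUnit T ∧ CompletelyPositive T

/-- The `F₂`-linear embeddings: complete isometries, unital for the two unital kinds. -/
def IsEmbedding (k : Kind) (F₂ : Type) [RCLike F₂] [NormedAlgebra F₂ 𝕜]
    {X Y : OperatorSpace.{u} 𝕜} (T : X.V → Y.V) : Prop :=
  IsLinearOver F₂ T ∧
    match k with
    | OSp => CompletelyIsometric T
    | OSp1 => MapsUnit T ∧ CompletelyIsometric T
    | OSy => MapsUnit T ∧ CompletelyIsometric T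

/-- The `𝕜`-linear maps by which a group may act: complete isometries, unital complete
isometries, and unital complete order isomorphisms (bijectivity is automatic for a group action). -/
def IsActionMap (k : Kind) {X : OperatorSpace.{u} 𝕜} (T : X.V →ₗ[𝕜] X.V) : Prop :=
  match k with
  | OSp => CompletelyIsometric (X := X) (Y := X) T
  | OSp1 => MapsUnit (X := X) (Y := X) T ∧ CompletelyIsometric (X := X) (Y := X) T
  | OSy => MapsUnit (X := X) (Y := X) T ∧ CompleteOrderEmbedding (X := X) (Y := X) T

end Kind

/-- A `𝕜`-`G`-operator space, unital `𝕜`-`G`-operator space or `𝕜`-`G`-operator system. -/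
structure GObject (k : Kind) (𝕜 : Type) [RCLike 𝕜] (G : Type u) [Group G] where
  space : OperatorSpace.{u} 𝕜
  isObject : k.IsObject space
  act : Representation 𝕜 G space.V
  isActionMap : ∀ g, k.IsActionMap (act g)

section Injectivity

variable {𝕜 : Type} [RCLike 𝕜]

/-- Injectivity in the category of kind `k` of `𝕜`-operator spaces and `F₂`-linear morphisms. -/
def IsInjective (k : Kind) (F₂ : Type) [RCLike F₂] [NormedAlgebra F₂ 𝕜]
    (Z : OperatorSpace.{u} 𝕜) : Prop :=
  ∀ X Y : OperatorSpace.{u} 𝕜, k.IsObject X → k.IsObject Y →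
    ∀ κ : X.V → Y.V, k.IsEmbedding F₂ κ →
    ∀ φ : X.V → Z.V, k.IsMorphism F₂ φ →
    ∃ ψ : Y.V → Z.V, k.IsMorphism F₂ ψ ∧ (∀ x, ψ (κ x) = φ x) ∧ cbNorm ψ = cbNorm φ

/-- Injectivity in the `G`-category of kind `k` of `𝕜`-`G`-operator spaces and `G`-equivariant
`F₂`-linear morphisms. -/
def IsGInjective {k : Kind} {G : Type u} [Group G] (F₂ : Type) [RCLike F₂] [NormedAlgebra F₂ 𝕜]
    (Z : GObject k 𝕜 G) : Prop :=
  ∀ X Y : GObject k 𝕜 G,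
    ∀ κ : X.space.V → Y.space.V, k.IsEmbedding F₂ κ → IsEquivariant X.act Y.act κ →
    ∀ φ : X.space.V → Z.space.V, k.IsMorphism F₂ φ → IsEquivariant X.act Z.act φ →
    ∃ ψ : Y.space.V → Z.space.V, k.IsMorphism F₂ ψ ∧ IsEquivariant Y.act Z.act ψ ∧
      (∀ x, ψ (κ x) = φ x) ∧ cbNorm ψ = cbNorm φ

end Injectivity

/-! ### The space `ℓ^∞(G, X)` -/

section LInf

variable {𝕜 : Type} [RCLike 𝕜] (G : Type u)

/-- The bounded functions from `G` to `X`. -/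
def boundedFunctions (X : OperatorSpace.{u} 𝕜) : Submodule 𝕜 (G → X.V) where
  carrier := {f | ∃ C : ℝ, ∀ s, ‖X.toOp (f s)‖ ≤ C}
  zero_mem' := ⟨0, fun s => by simp⟩
  add_mem' := by
    rintro f g ⟨C, hC⟩ ⟨D, hD⟩
    refine ⟨C + D, fun s => ?_⟩
    rw [Pi.add_apply, map_add]
    exact (norm_add_le _ _).trans (add_le_add (hC s) (hD s))
  smul_mem' := by
    rintro c f ⟨C, hC⟩
    refine ⟨‖c‖ * C, fun s => ?_⟩
    rw [Pi.smul_apply, map_smul, norm_smul]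
    exact mul_le_mul_of_nonneg_left (hC s) (norm_nonneg _)

variable {G} {H : Type u} [NormedAddCommGroup H] [InnerProductSpace 𝕜 H]

theorem diag_memlp {f : G → H →L[𝕜] H} {C : ℝ} (hC : ∀ s, ‖f s‖ ≤ C)
    (v : lp (fun _ : G => H) 2) : Memℓp (fun s => f s (v s)) 2 := by
  have h := ((lp.memℓp v).norm).const_mul C
  refine h.mono fun s => ?_
  exact ((f s).le_opNorm _).trans (mul_le_mul_of_nonneg_right (hC s) (norm_nonneg _))

/-- The diagonal operator on `ℓ²(G, H)` given by a bounded family of operators on `H`. -/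
def diagOp (f : G → H →L[𝕜] H) (hf : ∃ C : ℝ, ∀ s, ‖f s‖ ≤ C) :
    lp (fun _ : G => H) 2 →L[𝕜] lp (fun _ : G => H) 2 :=
  LinearMap.mkContinuousOfExistsBound
    { toFun := fun v => ⟨fun s => f s (v s), diag_memlp hf.choose_spec v⟩
      map_add' := fun v w => by
        apply lp.ext; funext s; exact map_add (f s) (v s) (w s)
      map_smul' := fun c v => by
        apply lp.ext; funext s; exact map_smul (f s) c (v s) }
    (by
      obtain ⟨C, hC⟩ := hf
      refine ⟨|C|, fun v => ?_⟩
      have h : ‖(C : 𝕜) • v‖ = |C| * ‖v‖ := by rw [norm_smul, RCLike.norm_ofReal]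
      rw [← h]
      refine lp.norm_mono (by simp) fun s => ?_
      change ‖f s (v s)‖ ≤ ‖(C : 𝕜) • v s‖
      rw [norm_smul, RCLike.norm_ofReal]
      exact ((f s).le_opNorm _).trans
        (mul_le_mul_of_nonneg_right ((hC s).trans (le_abs_self C)) (norm_nonneg _)))

theorem diagOp_apply (f : G → H →L[𝕜] H) (hf : ∃ C : ℝ, ∀ s, ‖f s‖ ≤ C)
    (v : lp (fun _ : G => H) 2) (s : G) : diagOp f hf v s = f s (v s) := rfl

variable (G)

/-- `ℓ^∞(G, X)`: the bounded functions from `G` to `X`, acting diagonally on `ℓ²(G, H)`. -/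
def ellInf (X : OperatorSpace.{u} 𝕜) : OperatorSpace.{u} 𝕜 where
  V := boundedFunctions G X
  H := lp (fun _ : G => X.H) 2
  toOp :=
    { toFun := fun f => diagOp (fun s => X.toOp (f.1 s)) f.2
      map_add' := fun f g => by
        ext v s
        change X.toOp (f.1 s + g.1 s) (v s) = X.toOp (f.1 s) (v s) + X.toOp (g.1 s) (v s)
        rw [map_add]; rfl
      map_smul' := fun c f => by
        ext v s
        change X.toOp (c • f.1 s) (v s) = c • X.toOp (f.1 s) (v s)
        rw [map_smul]; rfl }
  toOp_injective := by
    classical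
    intro f g h
    apply Subtype.ext
    funext s
    apply X.toOp_injective
    ext w
    let δ : lp (fun _ : G => X.H) 2 := lp.single (E := fun _ : G => X.H) 2 s w
    have hδ : δ s = w := lp.single_apply_self (E := fun _ : G => X.H) 2 s w
    have h1 := congrArg (fun T : lp (fun _ : G => X.H) 2 →L[𝕜] lp (fun _ : G => X.H) 2 =>
      T δ s) h
    change X.toOp (f.1 s) (δ s) = X.toOp (g.1 s) (δ s) at h1
    rwa [hδ] at h1

/-- The translation action `(t f)(s) = f(t⁻¹ s)` of `G` on `ℓ^∞(G, X)`. -/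
def translation [Group G] (X : OperatorSpace.{u} 𝕜) : Representation 𝕜 G (ellInf G X).V where
  toFun t :=
    { toFun := fun f => ⟨fun s => f.1 (t⁻¹ * s), f.2.imp fun _ hC s => hC (t⁻¹ * s)⟩
      map_add' := fun _ _ => rfl
      map_smul' := fun _ _ => rfl }
  map_one' := by
    ext f
    apply Subtype.ext
    funext s
    change f.1 (1⁻¹ * s) = f.1 s
    simp
  map_mul' t r := by
    ext f
    apply Subtype.ext
    funext s
    change f.1 ((t * r)⁻¹ * s) = f.1 (r⁻¹ * (t⁻¹ * s))
    simp [mul_assoc]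

end LInf

/-! ### The canonical embedding of a `G`-object `X` into `ℓ^∞(G, X)` -/

section Embedding

variable {𝕜 : Type} [RCLike 𝕜]

theorem norm_matOp_one {H : Type u} [NormedAddCommGroup H] [InnerProductSpace 𝕜 H]
    (a : Matrix (Fin 1) (Fin 1) (H →L[𝕜] H)) : ‖matOp a‖ = ‖a 0 0‖ := by
  have hn : ∀ v : PiLp 2 (fun _ : Fin 1 => H), ‖v‖ = ‖v 0‖ := fun v => by
    rw [PiLp.norm_eq_of_L2]; simp
  apply le_antisymm
  · refine ContinuousLinearMap.opNorm_le_bound _ (norm_nonneg _) fun v => ?_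
    rw [hn, hn, matOp_apply]
    simpa using (a 0 0).le_opNorm (v 0)
  · refine ContinuousLinearMap.opNorm_le_bound _ (norm_nonneg _) fun w => ?_
    have h := (matOp a).le_opNorm (WithLp.toLp 2 fun _ : Fin 1 => w)
    rw [hn, hn, matOp_apply] at h
    simpa using h

/-- Unital completely positive maps of operator systems are contractive. -/
theorem norm_le_of_completelyPositive {X Y : OperatorSpace.{u} 𝕜} (hX : X.IsSystem)
    (T : X.V →ₗ[𝕜] Y.V) (h1 : MapsUnit (X := X) (Y := Y) T)
    (hT : CompletelyPositive (X := X) (Y := Y) T) (x : X.V) : ‖Y.toOp (T x)‖ ≤ ‖X.toOp x‖ := by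
  obtain ⟨⟨e, he⟩, hs⟩ := hX
  obtain ⟨x', hx'⟩ := hs x
  have hTe := h1 e he
  rcases eq_or_ne x 0 with rfl | hx
  · simp
  set c : ℝ := ‖X.toOp x‖ with hc
  have hc0 : 0 < c := by
    rw [hc, norm_pos_iff]
    intro h0
    exact hx (X.toOp_injective (by rw [h0, map_zero]))
  let a : Matrix (Fin 2) (Fin 2) X.V := !![(c : 𝕜) • e, x; x', (c : 𝕜) • e]
  have key : ∀ v w, inner 𝕜 (X.toOp x v) w = inner 𝕜 v (X.toOp x' w) := fun v w => by
    rw [hx', ContinuousLinearMap.star_eq_adjoint, ContinuousLinearMap.adjoint_inner_right]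
  have key' : ∀ v w, inner 𝕜 (X.toOp x' v) w = inner 𝕜 v (X.toOp x w) := fun v w => by
    rw [hx', ContinuousLinearMap.star_eq_adjoint, ContinuousLinearMap.adjoint_inner_left]
  have hpos : X.MatPos a := by
    constructor
    · intro v w
      simp only [ContinuousLinearMap.coe_coe, OperatorSpace.mat, PiLp.inner_apply, matOp_apply,
        Fin.sum_univ_two]
      simp [a, he, inner_add_left, inner_add_right, inner_smul_left, inner_smul_right, key, key']
      ring
    · intro v
      simp only [ContinuousLinearMap.reApplyInnerSelf_apply, OperatorSpace.mat, PiLp.inner_apply,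
        matOp_apply, Fin.sum_univ_two]
      simp [a, he, inner_add_left, inner_smul_left, key', inner_self_eq_norm_sq_to_K]
      have hre : RCLike.re (inner 𝕜 (X.toOp x (v 1)) (v 0))
          = RCLike.re (inner 𝕜 (v 0) (X.toOp x (v 1))) := inner_re_symm _ _
      have hb : |RCLike.re (inner 𝕜 (v 0) (X.toOp x (v 1)))| ≤ ‖v 0‖ * (c * ‖v 1‖) :=
        (RCLike.abs_re_le_norm _).trans ((norm_inner_le_norm _ _).trans
          (mul_le_mul_of_nonneg_left ((X.toOp x).le_opNorm _) (norm_nonneg _)))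
      rw [hre]
      nlinarith [(abs_le.mp hb).1, mul_nonneg hc0.le (sq_nonneg (‖v 0‖ - ‖v 1‖))]
  have hq := hT 2 a hpos
  refine ContinuousLinearMap.opNorm_le_bound _ hc0.le fun w => ?_
  set y := Y.toOp (T x) w with hy
  have hq1 := hq.1 (WithLp.toLp 2 ![0, w]) (WithLp.toLp 2 ![y, 0])
  have hq2 := hq.2 (WithLp.toLp 2 ![-y, (c : 𝕜) • w])
  simp only [ContinuousLinearMap.coe_coe, OperatorSpace.mat, PiLp.inner_apply, matOp_apply,
        Fin.sum_univ_two] at hq1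
  simp only [ContinuousLinearMap.reApplyInnerSelf_apply, OperatorSpace.mat, PiLp.inner_apply,
        matOp_apply, Fin.sum_univ_two] at hq2
  simp [a, hTe, ← hy, inner_add_left, inner_smul_left, inner_smul_right] at hq1 hq2
  have hre : RCLike.re (inner 𝕜 (Y.toOp (T x') y) w) = ‖y‖ ^ 2 := by
    rw [inner_re_symm, ← hq1, ← RCLike.ofReal_pow, RCLike.ofReal_re]
  rw [hre] at hq2
  have h3 := nonneg_of_mul_nonneg_right hq2 hc0
  refine abs_le_of_sq_le_sq' ?_ (by positivity) |>.2
  nlinarith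

/-- Group actions on objects of any kind are isometric. -/
theorem GObject.norm_act {k : Kind} {G : Type u} [Group G] (X : GObject k 𝕜 G) (g : G)
    (x : X.space.V) : ‖X.space.toOp (X.act g x)‖ ≤ ‖X.space.toOp x‖ := by
  have hiso : CompletelyIsometric (X := X.space) (Y := X.space) (X.act g) →
      ‖X.space.toOp (X.act g x)‖ ≤ ‖X.space.toOp x‖ := fun h => by
    have h' := h 1 (fun _ _ => x)
    simp only [OperatorSpace.matNorm, OperatorSpace.mat, norm_matOp_one] at h'
    exact h'.le
  obtain ⟨S, hS, ρ, hρ⟩ := X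
  cases k with
  | OSp => exact hiso (hρ g)
  | OSp1 => exact hiso (hρ g).2
  | OSy => exact norm_le_of_completelyPositive hS _ (hρ g).1 (fun n a => ((hρ g).2 n a).1) x

/-- The canonical embedding `j : X → ℓ^∞(G, X)`, `j(x)(s) = s⁻¹ x`. -/
def GObject.j {k : Kind} {G : Type u} [Group G] (X : GObject k 𝕜 G) (x : X.space.V) :
    (ellInf G X.space).V :=
  ⟨fun s => X.act s⁻¹ x, ‖X.space.toOp x‖, fun s => X.norm_act s⁻¹ x⟩

end Embedding

end OpSp

end

/-!
An operator `x` is replaced by the real bilinear form `Re ⟨w, x v⟩`, so that the three pairs of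
scalar fields become one problem. Complete contractivity says that the forms of a matrix are
bounded by `(∑ ‖wᵢ‖² + ∑ ‖vⱼ‖²) / 2`, and a Hahn-Banach argument on `V ⊗ H ⊗ H` extends real-linear
complete contractions into `B(H)`; averaging over `{1, i}` restores linearity over the larger
fields. Unital complete positivity is the same as unital complete contractivity on an operator
system, because `a` is accretive if and only if `‖1 - t a‖ ≤ 1 + O(t²)` as `t ↓ 0`, and because
`x` has norm at most `c` if and only if the matrix with rows `(c, x)` and `(x*, c)` is positive.

As a product, `ℓ^∞(G, B(H))` is injective. If `X` is injective among `G`-objects, it is a retract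
both of `ℓ^∞(G, B(H))` and, equivariantly, of `ℓ^∞(G, X)`. Conversely, a non-equivariant extension
`ψ` is made equivariant by passing to its orbit map `b ↦ (s ↦ ψ (s⁻¹ b))` and applying an
equivariant retraction `ℓ^∞(G, X) → X`.
-/

noncomputable section

namespace OpSp

universe u

/-! ### Trilinear sums -/

section TrilinearSum

variable {R B M M' N : Type*} [CommSemiring R] [AddCommMonoid B] [Module R B]
  [AddCommMonoid M] [Module R M] [AddCommMonoid M'] [Module R M'] [AddCommMonoid N] [Module R N]
  {ι ι' κ κ' : Type*} [Fintype ι] [Fintype ι'] [Fintype κ] [Fintype κ']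
  (τ : B →ₗ[R] M →ₗ[R] M' →ₗ[R] N)

/-- The value of a matrix over `B` on two families of vectors, through a trilinear map `τ`. For the
form `τ x w v = Re ⟨w, x v⟩` this is `Re ⟨w, a v⟩`, for the universal `τ` it is an element of
`B ⊗ (M ⊗ M')`. -/
def trilinearSum (a : Matrix ι κ B) (w : ι → M) (v : κ → M') : N :=
  ∑ i, ∑ j, τ (a i j) (w i) (v j)

/-- The matrix `Vᵀ b W` for scalar matrices `V` and `W`. -/
def compress (V : Matrix ι ι' R) (W : Matrix κ κ' R) (b : Matrix ι κ B) : Matrix ι' κ' B :=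
  Matrix.of fun p q => ∑ i, V i p • ∑ j, W j q • b i j

theorem trilinearSum_sum_smul (b : Matrix ι κ B) (V : Matrix ι ι' R) (W : Matrix κ κ' R)
    (e : ι' → M) (f : κ' → M') :
    trilinearSum τ b (fun i => ∑ p, V i p • e p) (fun j => ∑ q, W j q • f q) =
      trilinearSum τ (compress V W b) e f := by
  simp only [trilinearSum, compress, Matrix.of_apply, map_sum, map_smul, LinearMap.sum_apply,
    LinearMap.smul_apply, Finset.smul_sum]
  calc ∑ i, ∑ j, ∑ q, ∑ p, W j q • V i p • τ (b i j) (e p) (f q)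
    _ = ∑ q, ∑ i, ∑ j, ∑ p, W j q • V i p • τ (b i j) (e p) (f q) := Finset.sum_comm_cycle
    _ = ∑ q, ∑ p, ∑ i, ∑ j, W j q • V i p • τ (b i j) (e p) (f q) :=
        Finset.sum_congr rfl fun _ _ => Finset.sum_comm_cycle
    _ = ∑ p, ∑ q, ∑ i, ∑ j, V i p • W j q • τ (b i j) (e p) (f q) := by
        rw [Finset.sum_comm]
        simp only [smul_comm (W _ _) (V _ _)]

theorem trilinearSum_smul_smul (c : R) (a : Matrix ι κ B) (w : ι → M) (v : κ → M') :
    trilinearSum τ a (c • w) (c • v) = (c * c) • trilinearSum τ a w v := by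
  simp only [trilinearSum, Pi.smul_apply, map_smul, LinearMap.smul_apply, smul_smul,
    Finset.smul_sum]

theorem trilinearSum_smul (c : R) (a : Matrix ι κ B) (w : ι → M) (v : κ → M') :
    trilinearSum τ (c • a) w v = c • trilinearSum τ a w v := by
  simp only [trilinearSum, Matrix.smul_apply, map_smul, LinearMap.smul_apply, Finset.smul_sum]

theorem trilinearSum_fromBlocks (a : Matrix ι κ B) (b : Matrix ι κ' B) (c : Matrix ι' κ B)
    (d : Matrix ι' κ' B) (w : ι → M) (w' : ι' → M) (v : κ → M') (v' : κ' → M') :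
    trilinearSum τ (Matrix.fromBlocks a b c d) (Sum.elim w w') (Sum.elim v v') =
      (trilinearSum τ a w v + trilinearSum τ b w v') +
        (trilinearSum τ c w' v + trilinearSum τ d w' v') := by
  simp only [trilinearSum, Fintype.sum_sum_type, Matrix.fromBlocks_apply₁₁,
    Matrix.fromBlocks_apply₁₂, Matrix.fromBlocks_apply₂₁, Matrix.fromBlocks_apply₂₂, Sum.elim_inl,
    Sum.elim_inr, Finset.sum_add_distrib]
  exact add_add_add_comm _ _ _ _

@[simp] theorem trilinearSum_zero (w : ι → M) (v : κ → M') :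
    trilinearSum τ (0 : Matrix ι κ B) w v = 0 := by
  simp [trilinearSum]

theorem trilinearSum_submatrix (a : Matrix ι κ B) (e : ι' ≃ ι) (f : κ' ≃ κ) (w : ι' → M)
    (v : κ' → M') :
    trilinearSum τ (a.submatrix e f) w v = trilinearSum τ a (w ∘ e.symm) (v ∘ f.symm) :=
  Fintype.sum_equiv e _ _ fun i => Fintype.sum_equiv f _ _ fun j => by simp

end TrilinearSum

/-! ### Bounds for matrices of bilinear forms -/

section FormBound

variable {A B H K : Type*} [AddCommGroup A] [Module ℝ A] [AddCommGroup B] [Module ℝ B]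
  [NormedAddCommGroup H] [InnerProductSpace ℝ H] [NormedAddCommGroup K] [InnerProductSpace ℝ K]
  {ι ι' κ κ' : Type*} [Fintype ι] [Fintype ι'] [Fintype κ] [Fintype κ']
  {β : B →ₗ[ℝ] K →ₗ[ℝ] K →ₗ[ℝ] ℝ}

theorem le_mul_norm_of_le_mean {f : H →ₗ[ℝ] K →ₗ[ℝ] ℝ} {C : ℝ}
    (h : ∀ w v, f w v ≤ C * ((‖w‖ ^ 2 + ‖v‖ ^ 2) / 2)) (w : H) (v : K) :
    f w v ≤ C * (‖w‖ * ‖v‖) := by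
  rcases eq_or_ne w 0 with rfl | hw
  · simp
  rcases eq_or_ne v 0 with rfl | hv
  · simp
  have pos : 0 < ‖v‖ * ‖w‖ := mul_pos (norm_pos_iff.mpr hv) (norm_pos_iff.mpr hw)
  have scaled := h (‖v‖ • w) (‖w‖ • v)
  simp only [map_smul, LinearMap.smul_apply, smul_eq_mul, norm_smul, norm_norm] at scaled
  refine le_of_mul_le_mul_left ?_ pos
  linarith

/-- The matrix of forms `β (a i j)` is bounded by `C`. The bound `C * ‖w‖ * ‖v‖` is encoded through
the arithmetic mean of `‖w‖ ^ 2` and `‖v‖ ^ 2`, which is equivalent by homogeneity and, unlike the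
product, is additive for direct sums. -/
def FormBound (β : B →ₗ[ℝ] K →ₗ[ℝ] K →ₗ[ℝ] ℝ) (a : Matrix ι κ B) (C : ℝ) : Prop :=
  ∀ w v, trilinearSum β a w v ≤ C * ((∑ i, ‖w i‖ ^ 2 + ∑ j, ‖v j‖ ^ 2) / 2)

namespace FormBound

theorem fromBlocks_diag {b : Matrix ι κ B} {b' : Matrix ι' κ' B} {C : ℝ} (hb : FormBound β b C)
    (hb' : FormBound β b' C) : FormBound β (Matrix.fromBlocks b 0 0 b') C := by
  intro w v
  rw [← Sum.elim_comp_inl_inr w, ← Sum.elim_comp_inl_inr v, trilinearSum_fromBlocks]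
  simp only [trilinearSum_zero, add_zero, zero_add, Fintype.sum_sum_type, Sum.elim_inl,
    Sum.elim_inr]
  linarith [hb (w ∘ Sum.inl) (v ∘ Sum.inl), hb' (w ∘ Sum.inr) (v ∘ Sum.inr)]

theorem mono {a : Matrix ι κ B} {C D : ℝ} (h : FormBound β a C) (hCD : C ≤ D) :
    FormBound β a D := fun w v =>
  (h w v).trans (mul_le_mul_of_nonneg_right hCD (by positivity))

theorem smul {a : Matrix ι κ B} {C c : ℝ} (h : FormBound β a C) (hc : 0 ≤ c) :
    FormBound β (c • a) (c * C) := fun w v => by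
  rw [trilinearSum_smul, smul_eq_mul, mul_assoc]
  exact mul_le_mul_of_nonneg_left (h w v) hc

theorem submatrix {a : Matrix ι κ B} {C : ℝ} (h : FormBound β a C) (e : ι' ≃ ι) (f : κ' ≃ κ) :
    FormBound β (a.submatrix e f) C := fun w v => by
  rw [trilinearSum_submatrix]
  refine (h _ _).trans_eq ?_
  simp only [Function.comp_apply, Equiv.sum_comp e.symm fun i => ‖w i‖ ^ 2,
    Equiv.sum_comp f.symm fun j => ‖v j‖ ^ 2]

end FormBound

theorem formBound_submatrix {a : Matrix ι κ B} {C : ℝ} (e : ι' ≃ ι) (f : κ' ≃ κ) :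
    FormBound β (a.submatrix e f) C ↔ FormBound β a C :=
  ⟨fun h => by simpa using h.submatrix e.symm f.symm, fun h => h.submatrix e f⟩

theorem formBound_fromBlocks_corner {a : Matrix ι κ B} {C : ℝ} (hC : 0 ≤ C) :
    FormBound β (Matrix.fromBlocks 0 a 0 0 : Matrix (ι ⊕ ι') (κ' ⊕ κ) B) C ↔ FormBound β a C := by
  refine ⟨fun h w v => ?_, fun h w v => ?_⟩
  · have := h (Sum.elim w 0) (Sum.elim 0 v)
    rw [trilinearSum_fromBlocks] at this
    simpa using this
  · rw [← Sum.elim_comp_inl_inr w, ← Sum.elim_comp_inl_inr v, trilinearSum_fromBlocks]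
    simp only [trilinearSum_zero, add_zero, zero_add, Fintype.sum_sum_type, Sum.elim_inl,
      Sum.elim_inr]
    refine (h _ _).trans (mul_le_mul_of_nonneg_left ?_ hC)
    have hw : 0 ≤ ∑ i, ‖(w ∘ Sum.inr) i‖ ^ 2 := by positivity
    have hv : 0 ≤ ∑ j, ‖(v ∘ Sum.inl) j‖ ^ 2 := by positivity
    linarith

theorem sum_norm_sq_sum_smul [DecidableEq κ] {V : Matrix ι κ ℝ} (hV : V.transpose * V = 1)
    (e : κ → H) : ∑ i, ‖∑ p, V i p • e p‖ ^ 2 = ∑ p, ‖e p‖ ^ 2 := by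
  have orthonormal_columns (p q) : ∑ i, V i p * V i q = if p = q then 1 else 0 := by
    simpa [Matrix.mul_apply, Matrix.one_apply] using congrFun (congrFun hV p) q
  calc ∑ i, ‖∑ p, V i p • e p‖ ^ 2
    _ = ∑ i, ∑ p, ∑ q, V i p * V i q * inner ℝ (e q) (e p) := by
        simp only [← real_inner_self_eq_norm_sq, sum_inner, inner_sum, real_inner_smul_left,
          real_inner_smul_right, mul_assoc]
    _ = ∑ p, ∑ q, (∑ i, V i p * V i q) * inner ℝ (e q) (e p) := by
        rw [← Finset.sum_comm_cycle]
        simp only [Finset.sum_mul]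
    _ = ∑ p, ‖e p‖ ^ 2 := by simp [orthonormal_columns]

theorem FormBound.compress [DecidableEq ι'] [DecidableEq κ'] {b : Matrix ι κ B} {C : ℝ}
    (hb : FormBound β b C) {V : Matrix ι ι' ℝ} {W : Matrix κ κ' ℝ} (hV : V.transpose * V = 1)
    (hW : W.transpose * W = 1) : FormBound β (compress V W b) C := fun w v => by
  rw [← trilinearSum_sum_smul]
  refine (hb _ _).trans_eq ?_
  rw [sum_norm_sq_sum_smul hV, sum_norm_sq_sum_smul hW]

/-- `φ` is completely bounded by `c` relative to `β`: a matrix over `A` whose `β`-form is bounded by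
one has a `φ`-form bounded by `c`. -/
def FormDominated (β : A →ₗ[ℝ] K →ₗ[ℝ] K →ₗ[ℝ] ℝ) (φ : A →ₗ[ℝ] H →ₗ[ℝ] H →ₗ[ℝ] ℝ) (c : ℝ) :
    Prop :=
  ∀ ⦃ι κ : Type⦄ [Fintype ι] [Fintype κ] (a : Matrix ι κ A), FormBound β a 1 → FormBound φ a c

end FormBound

/-! ### The Hahn–Banach extension of dominated trilinear forms -/

section Extension

open scoped TensorProduct

variable {A B H K : Type*} [AddCommGroup A] [Module ℝ A] [AddCommGroup B] [Module ℝ B]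
  [NormedAddCommGroup H] [InnerProductSpace ℝ H] [NormedAddCommGroup K] [InnerProductSpace ℝ K]

theorem exists_extension_le_of_injective {E F : Type*} [AddCommGroup E] [Module ℝ E]
    [AddCommGroup F] [Module ℝ F] {κ : E →ₗ[ℝ] F} (hκ : Function.Injective κ) {N : F → ℝ}
    (N_smul : ∀ c : ℝ, 0 < c → ∀ x, N (c • x) = c * N x) (N_add : ∀ x y, N (x + y) ≤ N x + N y)
    {f : E →ₗ[ℝ] ℝ} (hf : ∀ x, f x ≤ N (κ x)) :
    ∃ g : F →ₗ[ℝ] ℝ, g ∘ₗ κ = f ∧ ∀ y, g y ≤ N y := by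
  let e := LinearEquiv.ofInjective κ hκ
  obtain ⟨g, hg, hgN⟩ := exists_extension_of_le_sublinear
    ⟨LinearMap.range κ, f ∘ₗ e.symm.toLinearMap⟩ N N_smul N_add fun y => by
      simpa [e] using hf (e.symm y)
  exact ⟨g, LinearMap.ext fun x => (hg (e x)).trans (congrArg f (e.symm_apply_apply x)), hgN⟩

/-- The curried form of a linear map on `A ⊗ (H ⊗ H)`. -/
def trilinearCurry {N : Type*} [AddCommGroup N] [Module ℝ N] :
    (A ⊗[ℝ] (H ⊗[ℝ] H) →ₗ[ℝ] N) ≃ₗ[ℝ] (A →ₗ[ℝ] H →ₗ[ℝ] H →ₗ[ℝ] N) :=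
  (TensorProduct.lift.equiv (RingHom.id ℝ) A (H ⊗[ℝ] H) N).symm ≪≫ₗ
    (TensorProduct.lift.equiv (RingHom.id ℝ) H H N).symm.congrRight

@[simp] theorem trilinearCurry_apply {N : Type*} [AddCommGroup N] [Module ℝ N]
    (f : A ⊗[ℝ] (H ⊗[ℝ] H) →ₗ[ℝ] N) (a : A) (h k : H) :
    trilinearCurry f a h k = f (a ⊗ₜ (h ⊗ₜ k)) := rfl

theorem trilinearCurry_symm_tmul {N : Type*} [AddCommGroup N] [Module ℝ N]
    (φ : A →ₗ[ℝ] H →ₗ[ℝ] H →ₗ[ℝ] N) (a : A) (h k : H) :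
    trilinearCurry.symm φ (a ⊗ₜ (h ⊗ₜ k)) = φ a h k := by
  rw [← trilinearCurry_apply, LinearEquiv.apply_symm_apply]

/-- The tensor `∑ a i j ⊗ (h i ⊗ k j)`. -/
def tensorSum {ι κ : Type*} [Fintype ι] [Fintype κ] (a : Matrix ι κ A) (h : ι → H) (k : κ → H) :
    A ⊗[ℝ] (H ⊗[ℝ] H) :=
  trilinearSum (trilinearCurry LinearMap.id) a h k

theorem map_tensorSum {N : Type*} [AddCommGroup N] [Module ℝ N] {ι κ : Type*} [Fintype ι]
    [Fintype κ] (f : A ⊗[ℝ] (H ⊗[ℝ] H) →ₗ[ℝ] N) (a : Matrix ι κ A) (h : ι → H) (k : κ → H) :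
    f (tensorSum a h k) = trilinearSum (trilinearCurry f) a h k := by
  simp [tensorSum, trilinearSum]

/-- The costs of the presentations of `z` through matrices bounded by one. -/
def costs (β : B →ₗ[ℝ] K →ₗ[ℝ] K →ₗ[ℝ] ℝ) (z : B ⊗[ℝ] (H ⊗[ℝ] H)) : Set ℝ :=
  {t | ∃ (ι κ : Type) (_ : Fintype ι) (_ : Fintype κ) (b : Matrix ι κ B) (h : ι → H) (k : κ → H),
    FormBound β b 1 ∧ z = tensorSum b h k ∧ t = (∑ i, ‖h i‖ ^ 2 + ∑ j, ‖k j‖ ^ 2) / 2}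

/-- The Haagerup-type seminorm for which linear functionals dominated by `c * minCost β` correspond
to trilinear forms dominated by `c` relative to `β`. -/
def minCost (β : B →ₗ[ℝ] K →ₗ[ℝ] K →ₗ[ℝ] ℝ) (z : B ⊗[ℝ] (H ⊗[ℝ] H)) : ℝ := sInf (costs β z)

variable {β : B →ₗ[ℝ] K →ₗ[ℝ] K →ₗ[ℝ] ℝ}

theorem bddBelow_costs (z : B ⊗[ℝ] (H ⊗[ℝ] H)) : BddBelow (costs β z) := by
  refine ⟨0, ?_⟩
  rintro t ⟨ι, κ, _, _, b, h, k, -, -, rfl⟩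
  positivity

theorem add_mem_costs {z z' : B ⊗[ℝ] (H ⊗[ℝ] H)} {t t' : ℝ} (ht : t ∈ costs β z)
    (ht' : t' ∈ costs β z') : t + t' ∈ costs β (z + z') := by
  obtain ⟨ι, κ, _, _, b, h, k, hb, rfl, rfl⟩ := ht
  obtain ⟨ι', κ', _, _, b', h', k', hb', rfl, rfl⟩ := ht'
  refine ⟨ι ⊕ ι', κ ⊕ κ', inferInstance, inferInstance, Matrix.fromBlocks b 0 0 b',
    Sum.elim h h', Sum.elim k k', hb.fromBlocks_diag hb', ?_, ?_⟩
  · simp [tensorSum, trilinearSum_fromBlocks]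
  · simp only [Fintype.sum_sum_type, Sum.elim_inl, Sum.elim_inr]
    ring

theorem smul_mem_costs {z : B ⊗[ℝ] (H ⊗[ℝ] H)} {t c : ℝ} (hc : 0 ≤ c) (ht : t ∈ costs β z) :
    c * t ∈ costs β (c • z) := by
  obtain ⟨ι, κ, _, _, b, h, k, hb, rfl, rfl⟩ := ht
  refine ⟨ι, κ, inferInstance, inferInstance, b, √c • h, √c • k, hb, ?_, ?_⟩
  · rw [tensorSum, tensorSum, trilinearSum_smul_smul, Real.mul_self_sqrt hc]
  · simp only [Pi.smul_apply, norm_smul, mul_pow, Real.norm_eq_abs, sq_abs, Real.sq_sqrt hc,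
      ← Finset.mul_sum]
    ring

/-- All the forms `β b` are bounded. -/
def BoundedForms (β : B →ₗ[ℝ] K →ₗ[ℝ] K →ₗ[ℝ] ℝ) : Prop :=
  ∀ b, ∃ C : ℝ, ∀ w v, β b w v ≤ C * (‖w‖ * ‖v‖)

theorem BoundedForms.costs_tmul_nonempty (hβ : BoundedForms β) (b : B) (h k : H) :
    (costs β (b ⊗ₜ[ℝ] (h ⊗ₜ[ℝ] k))).Nonempty := by
  obtain ⟨C, hC⟩ := hβ b
  have hD : 0 < max C 1 := lt_max_of_lt_right one_pos
  refine ⟨_, Unit, Unit, inferInstance, inferInstance, fun _ _ => (max C 1)⁻¹ • b,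
    fun _ => max C 1 • h, fun _ => k, fun w v => ?_, ?_, rfl⟩
  · have hle : (max C 1)⁻¹ * β b (w ()) (v ()) ≤ ‖w ()‖ * ‖v ()‖ := by
      rw [inv_mul_le_iff₀ hD]
      exact (hC _ _).trans (mul_le_mul_of_nonneg_right (le_max_left _ _) (by positivity))
    simp only [trilinearSum, Finset.univ_unique, Finset.sum_singleton, map_smul,
      LinearMap.smul_apply, smul_eq_mul, PUnit.default_eq_unit]
    linarith [two_mul_le_add_sq ‖w ()‖ ‖v ()‖]
  · simp [tensorSum, trilinearSum, smul_smul, hD.ne']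

theorem BoundedForms.costs_nonempty (hβ : BoundedForms β) (z : B ⊗[ℝ] (H ⊗[ℝ] H)) :
    (costs β z).Nonempty := by
  induction z using TensorProduct.induction_on with
  | zero => simpa using hβ.costs_tmul_nonempty 0 (0 : H) 0
  | tmul b y =>
    induction y using TensorProduct.induction_on with
    | zero => simpa using hβ.costs_tmul_nonempty b (0 : H) 0
    | tmul h k => exact hβ.costs_tmul_nonempty b h k
    | add x y hx hy =>
      rw [TensorProduct.tmul_add]
      exact ⟨_, add_mem_costs hx.some_mem hy.some_mem⟩
  | add x y hx hy => exact ⟨_, add_mem_costs hx.some_mem hy.some_mem⟩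

theorem minCost_le {ι κ : Type} [Fintype ι] [Fintype κ] {b : Matrix ι κ B} (hb : FormBound β b 1)
    (h : ι → H) (k : κ → H) :
    minCost β (tensorSum b h k) ≤ (∑ i, ‖h i‖ ^ 2 + ∑ j, ‖k j‖ ^ 2) / 2 :=
  csInf_le (bddBelow_costs _) ⟨ι, κ, _, _, b, h, k, hb, rfl, rfl⟩

theorem BoundedForms.minCost_smul_le (hβ : BoundedForms β) {c : ℝ} (hc : 0 < c)
    (z : B ⊗[ℝ] (H ⊗[ℝ] H)) : minCost β (c • z) ≤ c * minCost β z := by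
  rw [← div_le_iff₀' hc]
  refine le_csInf (hβ.costs_nonempty z) fun t ht => ?_
  rw [div_le_iff₀' hc]
  exact csInf_le (bddBelow_costs _) (smul_mem_costs hc.le ht)

theorem BoundedForms.minCost_smul (hβ : BoundedForms β) {c : ℝ} (hc : 0 < c)
    (z : B ⊗[ℝ] (H ⊗[ℝ] H)) : minCost β (c • z) = c * minCost β z := by
  refine (hβ.minCost_smul_le hc z).antisymm ?_
  simpa [inv_smul_smul₀ hc.ne', le_inv_mul_iff₀ hc] using
    hβ.minCost_smul_le (inv_pos.mpr hc) (c • z)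

theorem BoundedForms.minCost_add_le (hβ : BoundedForms β) (z z' : B ⊗[ℝ] (H ⊗[ℝ] H)) :
    minCost β (z + z') ≤ minCost β z + minCost β z' := by
  rw [minCost, minCost, minCost, ← csInf_add (hβ.costs_nonempty z) (bddBelow_costs z)
    (hβ.costs_nonempty z') (bddBelow_costs z')]
  refine csInf_le_csInf (bddBelow_costs _) ((hβ.costs_nonempty z).add (hβ.costs_nonempty z')) ?_
  rintro _ ⟨t, ht, t', ht', rfl⟩
  exact add_mem_costs ht ht'

/-- Evaluation of the two vector legs against `x` and `y`. -/
def slice (x y : H) : A ⊗[ℝ] (H ⊗[ℝ] H) →ₗ[ℝ] A :=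
  (TensorProduct.rid ℝ A).toLinearMap ∘ₗ LinearMap.lTensor A
    ((TensorProduct.rid ℝ ℝ).toLinearMap ∘ₗ
      TensorProduct.map (innerSL ℝ x).toLinearMap (innerSL ℝ y).toLinearMap)

theorem slice_tmul (x y : H) (a : A) (h k : H) :
    slice x y (a ⊗ₜ (h ⊗ₜ k)) = (inner ℝ x h * inner ℝ y k) • a := by
  simp [slice, mul_comm]

theorem slice_rTensor (κ : A →ₗ[ℝ] B) (x y : H) (z : A ⊗[ℝ] (H ⊗[ℝ] H)) :
    slice x y (κ.rTensor (H ⊗[ℝ] H) z) = κ (slice x y z) := by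
  rw [← LinearMap.comp_apply, ← LinearMap.comp_apply]
  congr 1
  ext a h k
  simp [slice_tmul]

theorem rTensor_tensorSum {ι ι' : Type*} [Fintype ι] [Fintype ι'] (κ : A →ₗ[ℝ] B)
    (a : Matrix ι ι' A) (h : ι → H) (k : ι' → H) :
    κ.rTensor (H ⊗[ℝ] H) (tensorSum a h k) = tensorSum (a.map κ) h k := by
  simp [tensorSum, trilinearSum]

theorem injective_rTensor {κ : A →ₗ[ℝ] B} (hκ : Function.Injective κ) :
    Function.Injective (κ.rTensor (H ⊗[ℝ] H)) :=
  Module.Flat.rTensor_preserves_injective_linearMap κ hκ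

theorem exists_tensorSum_of_rTensor_eq {κ : A →ₗ[ℝ] B} (hκ : Function.Injective κ)
    {m n : Type*} [Fintype m] [Fintype n] [DecidableEq m] [DecidableEq n]
    {b : Matrix m n B} {e x : m → H} {f y : n → H}
    (hx : ∀ p q, inner ℝ (x p) (e q) = if p = q then (1 : ℝ) else 0)
    (hy : ∀ p q, inner ℝ (y p) (f q) = if p = q then (1 : ℝ) else 0)
    {z : A ⊗[ℝ] (H ⊗[ℝ] H)} (hz : κ.rTensor (H ⊗[ℝ] H) z = tensorSum b e f) :
    ∃ a : Matrix m n A, a.map κ = b ∧ z = tensorSum a e f := by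
  have hab : (Matrix.of fun p q => slice (x p) (y q) z).map κ = b := by
    ext p q
    rw [Matrix.map_apply, Matrix.of_apply, ← slice_rTensor, hz, map_tensorSum]
    simp [trilinearSum, slice_tmul, hx, hy]
  refine ⟨_, hab, injective_rTensor hκ ?_⟩
  rw [hz, rTensor_tensorSum, hab]

/-- The linear map `y ↦ (⟪h i, y⟫)ᵢ`. -/
def innerFamily {ι : Type*} [Fintype ι] (h : ι → H) : H →ₗ[ℝ] EuclideanSpace ℝ ι :=
  (WithLp.linearEquiv 2 ℝ (ι → ℝ)).symm.toLinearMap ∘ₗ LinearMap.pi fun i => innerₗ H (h i)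

theorem inner_sum_smul_eq_inner_innerFamily {ι : Type*} [Fintype ι] (h : ι → H)
    (u : EuclideanSpace ℝ ι) (y : H) :
    inner ℝ (∑ i, u i • h i) y = inner ℝ u (innerFamily h y) := by
  simp [innerFamily, PiLp.inner_apply, sum_inner, real_inner_smul_left, mul_comm]

/-- The columns of `V` are an orthonormal basis of the range of `y ↦ (⟪h i, y⟫)ᵢ`. -/
theorem exists_isometry_dual {ι : Type*} [Fintype ι] (h : ι → H) :
    ∃ (m : ℕ) (V : Matrix ι (Fin m) ℝ) (e x : Fin m → H), V.transpose * V = 1 ∧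
      (∀ i, h i = ∑ p, V i p • e p) ∧
      ∀ p q, inner ℝ (x p) (e q) = if p = q then (1 : ℝ) else 0 := by
  let o := stdOrthonormalBasis ℝ (LinearMap.range (innerFamily h))
  have exists_preimage (p) : ∃ x, innerFamily h x = o p := (o p).2
  choose x hx using exists_preimage
  have inner_o (p q) : inner ℝ (o p : EuclideanSpace ℝ ι) (o q) = if p = q then 1 else 0 :=
    orthonormal_iff_ite.mp o.orthonormal p q
  refine ⟨_, Matrix.of fun i p => (o p : EuclideanSpace ℝ ι) i,
    fun p => ∑ i, (o p : EuclideanSpace ℝ ι) i • h i, x, ?_, fun i => ?_, fun p q => ?_⟩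
  · ext p q
    rw [Matrix.one_apply, ← inner_o p q]
    simp [Matrix.mul_apply, PiLp.inner_apply, mul_comm]
  · refine ext_inner_right ℝ fun y => ?_
    calc inner ℝ (h i) y
      _ = (innerFamily h y) i := rfl
      _ = ∑ p, (o p : EuclideanSpace ℝ ι) i *
            inner ℝ (o p : EuclideanSpace ℝ ι) (innerFamily h y) := by
          have expansion := congrArg Subtype.val (o.sum_repr ⟨innerFamily h y, y, rfl⟩)
          simp only [o.repr_apply_apply, Submodule.coe_inner, Submodule.coe_sum,
            Submodule.coe_smul] at expansion
          conv_lhs => rw [← expansion]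
          simp [mul_comm]
      _ = inner ℝ (∑ p, (o p : EuclideanSpace ℝ ι) i • ∑ j, (o p : EuclideanSpace ℝ ι) j • h j)
            y := by
          simp only [sum_inner (𝕜 := ℝ) _ _ y, real_inner_smul_left,
            ← inner_sum_smul_eq_inner_innerFamily]
  · rw [real_inner_comm, inner_sum_smul_eq_inner_innerFamily, hx, inner_o]
    simp only [eq_comm]

theorem FormDominated.le_mul_of_mem_costs {κ : A →ₗ[ℝ] B} (hκ : Function.Injective κ)
    {φ : A →ₗ[ℝ] H →ₗ[ℝ] H →ₗ[ℝ] ℝ} {c : ℝ} (hφ : FormDominated (β ∘ₗ κ) φ c)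
    {z : A ⊗[ℝ] (H ⊗[ℝ] H)} {t : ℝ} (ht : t ∈ costs β (κ.rTensor (H ⊗[ℝ] H) z)) :
    trilinearCurry.symm φ z ≤ c * t := by
  obtain ⟨ι, ι', _, _, b, h, k, hb, hz, rfl⟩ := ht
  obtain ⟨m, V, e, x, hV, hh, hx⟩ := exists_isometry_dual h
  obtain ⟨n, W, f, y, hW, hk, hy⟩ := exists_isometry_dual k
  obtain rfl : h = fun i => ∑ p, V i p • e p := funext hh
  obtain rfl : k = fun j => ∑ q, W j q • f q := funext hk
  rw [tensorSum, trilinearSum_sum_smul] at hz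
  obtain ⟨a, hab, rfl⟩ := exists_tensorSum_of_rTensor_eq hκ hx hy hz
  have ha : FormBound (β ∘ₗ κ) a 1 := by
    have := hb.compress hV hW
    rwa [← hab] at this
  rw [map_tensorSum, LinearEquiv.apply_symm_apply, sum_norm_sq_sum_smul hV,
    sum_norm_sq_sum_smul hW]
  exact hφ a ha e f

theorem FormDominated.le_mul_minCost (hβ : BoundedForms β) {κ : A →ₗ[ℝ] B}
    (hκ : Function.Injective κ) {φ : A →ₗ[ℝ] H →ₗ[ℝ] H →ₗ[ℝ] ℝ} {c : ℝ} (hc : 0 ≤ c)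
    (hφ : FormDominated (β ∘ₗ κ) φ c) (z : A ⊗[ℝ] (H ⊗[ℝ] H)) :
    trilinearCurry.symm φ z ≤ c * minCost β (κ.rTensor (H ⊗[ℝ] H) z) := by
  have hne := hβ.costs_nonempty (κ.rTensor (H ⊗[ℝ] H) z)
  rw [minCost, ← smul_eq_mul, ← Real.sInf_smul_of_nonneg hc]
  refine le_csInf (hne.smul_set) ?_
  rintro _ ⟨t, ht, rfl⟩
  exact hφ.le_mul_of_mem_costs hκ ht

theorem FormDominated.exists_extension (hβ : BoundedForms β) {κ : A →ₗ[ℝ] B}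
    (hκ : Function.Injective κ) {φ : A →ₗ[ℝ] H →ₗ[ℝ] H →ₗ[ℝ] ℝ} {c : ℝ} (hc : 0 ≤ c)
    (hφ : FormDominated (β ∘ₗ κ) φ c) :
    ∃ g : B →ₗ[ℝ] H →ₗ[ℝ] H →ₗ[ℝ] ℝ, g ∘ₗ κ = φ ∧ FormDominated β g c := by
  obtain ⟨g, hg, hgN⟩ := exists_extension_le_of_injective (injective_rTensor hκ)
    (N := fun z => c * minCost β z)
    (fun r hr z => by rw [hβ.minCost_smul hr, mul_left_comm])
    (fun z z' => by
      rw [← mul_add]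
      exact mul_le_mul_of_nonneg_left (hβ.minCost_add_le z z') hc)
    (hφ.le_mul_minCost hβ hκ hc)
  refine ⟨trilinearCurry g, ?_, fun ι ι' _ _ b hb h k => ?_⟩
  · ext a h k
    simpa [trilinearCurry_symm_tmul] using LinearMap.congr_fun hg (a ⊗ₜ (h ⊗ₜ k))
  · rw [← map_tensorSum]
    exact (hgN _).trans (mul_le_mul_of_nonneg_left (minCost_le hb h k) hc)

end Extension

/-! ### The bilinear forms of an operator space -/

namespace OperatorSpace

variable {𝕜 : Type} [RCLike 𝕜] (X : OperatorSpace.{u} 𝕜)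

instance : Module ℝ X.V := Module.compHom X.V (algebraMap ℝ 𝕜)

instance : IsScalarTower ℝ 𝕜 X.V := IsScalarTower.of_algebraMap_smul fun _ _ => rfl

instance : InnerProductSpace ℝ X.H := InnerProductSpace.rclikeToReal 𝕜 X.H

instance : IsScalarTower ℝ 𝕜 X.H := IsScalarTower.of_algebraMap_smul fun _ _ => rfl

/-- The real bilinear forms `(w, v) ↦ Re ⟨w, x v⟩` of the elements of `X`. Passing to real parts
treats real and complex scalars, and maps that are only real-linear, in the same way. -/
def form : X.V →ₗ[ℝ] X.H →ₗ[ℝ] X.H →ₗ[ℝ] ℝ where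
  toFun x := (innerₗ X.H).compl₂ ((X.toOp x).toLinearMap.restrictScalars ℝ)
  map_add' x y := by ext; simp [inner_add_right]
  map_smul' c x := by
    ext w v
    rw [← algebraMap_smul 𝕜 c x]
    simp

theorem form_apply (x : X.V) (w v : X.H) : X.form x w v = inner ℝ w (X.toOp x v) := rfl

variable {X}

theorem form_le (x : X.V) (w v : X.H) : X.form x w v ≤ ‖X.toOp x‖ * (‖w‖ * ‖v‖) := by
  rw [mul_left_comm]
  exact (real_inner_le_norm _ _).trans
    (mul_le_mul_of_nonneg_left ((X.toOp x).le_opNorm v) (norm_nonneg w))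

theorem boundedForms_form : BoundedForms X.form := fun x => ⟨‖X.toOp x‖, form_le x⟩

theorem inner_mat {n : ℕ} (a : Matrix (Fin n) (Fin n) X.V) (w v : PiLp 2 fun _ : Fin n => X.H) :
    inner ℝ w (X.mat a v) = trilinearSum X.form a w.ofLp v.ofLp := by
  simp [PiLp.inner_apply, mat, matOp_apply, inner_sum, trilinearSum, form_apply]

theorem re_inner_eq_real_inner {n : ℕ} (w v : PiLp 2 fun _ : Fin n => X.H) :
    RCLike.re (inner 𝕜 w v) = inner ℝ w v := by
  simp only [PiLp.inner_apply, map_sum]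
  rfl

theorem norm_le_iff_inner_le {n : ℕ}
    (S : (PiLp 2 fun _ : Fin n => X.H) →L[𝕜] PiLp 2 fun _ : Fin n => X.H) {C : ℝ} (hC : 0 ≤ C) :
    ‖S‖ ≤ C ↔ ∀ w v, inner ℝ w (S v) ≤ C * ((‖w‖ ^ 2 + ‖v‖ ^ 2) / 2) := by
  refine ⟨fun h w v => ?_, fun h => S.opNorm_le_bound hC fun v => ?_⟩
  · calc inner ℝ w (S v)
      _ ≤ ‖w‖ * ‖S v‖ := real_inner_le_norm _ _
      _ ≤ ‖w‖ * (C * ‖v‖) := by gcongr; exact S.le_of_opNorm_le h v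
      _ ≤ C * ((‖w‖ ^ 2 + ‖v‖ ^ 2) / 2) := by nlinarith [mul_nonneg hC (sq_nonneg (‖w‖ - ‖v‖))]
  · rcases eq_or_ne (S v) 0 with hv | hv
    · rw [hv, norm_zero]
      positivity
    let f := (innerₗ (PiLp 2 fun _ : Fin n => X.H)).compl₂ (S.toLinearMap.restrictScalars ℝ)
    have inner_le : inner ℝ (S v) (S v) ≤ C * (‖S v‖ * ‖v‖) :=
      le_mul_norm_of_le_mean (f := f) h (S v) v
    rw [real_inner_self_eq_norm_sq] at inner_le
    refine le_of_mul_le_mul_left ?_ (norm_pos_iff.mpr hv)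
    linarith

theorem matNorm_le_iff {n : ℕ} {a : Matrix (Fin n) (Fin n) X.V} {C : ℝ} (hC : 0 ≤ C) :
    X.matNorm a ≤ C ↔ FormBound X.form a C := by
  rw [matNorm, norm_le_iff_inner_le _ hC]
  simp only [inner_mat, PiLp.norm_sq_eq_of_L2]
  exact ⟨fun h w v => h (WithLp.toLp 2 w) (WithLp.toLp 2 v), fun h w v => h _ _⟩

theorem norm_toOp_eq_matNorm (x : X.V) :
    ‖X.toOp x‖ = X.matNorm (Matrix.of fun _ _ : Fin 1 => x) := by
  rw [matNorm, mat, norm_matOp_one]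
  rfl

end OperatorSpace

/-! ### Completely bounded maps -/

section CompletelyBounded

variable {𝕜 : Type} [RCLike 𝕜] {X Y Z : OperatorSpace.{u} 𝕜}

theorem FormDominated.formBound {A H K : Type*} [AddCommGroup A] [Module ℝ A]
    [NormedAddCommGroup H] [InnerProductSpace ℝ H] [NormedAddCommGroup K] [InnerProductSpace ℝ K]
    {β : A →ₗ[ℝ] K →ₗ[ℝ] K →ₗ[ℝ] ℝ} {φ : A →ₗ[ℝ] H →ₗ[ℝ] H →ₗ[ℝ] ℝ} {c C : ℝ}
    (h : FormDominated β φ c) (hC : 0 ≤ C) {ι κ : Type} [Fintype ι] [Fintype κ] {a : Matrix ι κ A}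
    (ha : FormBound β a C) : FormBound φ a (C * c) := fun w v => by
  have bound_of_gt (D : ℝ) (hD : D ∈ Set.Ioi C) :
      trilinearSum φ a w v ≤ D * c * ((∑ i, ‖w i‖ ^ 2 + ∑ j, ‖v j‖ ^ 2) / 2) := by
    have hD₀ : 0 < D := hC.trans_lt hD
    have normalized : FormBound β (D⁻¹ • a) 1 := by
      simpa [inv_mul_cancel₀ hD₀.ne'] using (ha.mono hD.le).smul (inv_nonneg.mpr hD₀.le)
    simpa [smul_inv_smul₀ hD₀.ne'] using (h _ normalized).smul hD₀.le w v
  have cont : Continuous fun D : ℝ => D * c * ((∑ i, ‖w i‖ ^ 2 + ∑ j, ‖v j‖ ^ 2) / 2) := by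
    fun_prop
  exact ge_of_tendsto ((cont.tendsto C).mono_left nhdsWithin_le_nhds)
    (Filter.eventually_of_mem self_mem_nhdsWithin bound_of_gt)

theorem FormDominated.boundedForms {A H K : Type*} [AddCommGroup A] [Module ℝ A]
    [NormedAddCommGroup H] [InnerProductSpace ℝ H] [NormedAddCommGroup K] [InnerProductSpace ℝ K]
    {β : A →ₗ[ℝ] K →ₗ[ℝ] K →ₗ[ℝ] ℝ} {φ : A →ₗ[ℝ] H →ₗ[ℝ] H →ₗ[ℝ] ℝ} {c : ℝ}
    (h : FormDominated β φ c) (hβ : BoundedForms β) : BoundedForms φ := fun b => by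
  obtain ⟨C, hC⟩ := hβ b
  have bound : FormBound β (Matrix.of fun _ _ : Unit => b) |C| := fun w v => by
    have : 0 ≤ |C| * (‖w ()‖ - ‖v ()‖) ^ 2 := by positivity
    have := (hC (w ()) (v ())).trans (mul_le_mul_of_nonneg_right (le_abs_self C) (by positivity))
    simp only [trilinearSum, Finset.univ_unique, Finset.sum_singleton, Matrix.of_apply]
    linarith
  refine ⟨|C| * c, le_mul_norm_of_le_mean fun w v => ?_⟩
  simpa [trilinearSum] using h.formBound (abs_nonneg C) bound (fun _ => w) fun _ => v

/-- All amplifications `Tₙ : Mₙ(X) → Mₙ(Y)` are bounded by `c`. -/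
def CompletelyBoundedBy (T : X.V → Y.V) (c : ℝ) : Prop :=
  ∀ (n : ℕ) (a : Matrix (Fin n) (Fin n) X.V), Y.matNorm (a.map T) ≤ c * X.matNorm a

theorem completelyBoundedBy_one_iff {T : X.V → Y.V} :
    CompletelyBoundedBy T 1 ↔ CompletelyContractive T := by
  simp only [CompletelyBoundedBy, one_mul, CompletelyContractive]

theorem OperatorSpace.matNorm_nonneg {n : ℕ} (a : Matrix (Fin n) (Fin n) X.V) : 0 ≤ X.matNorm a :=
  norm_nonneg _

theorem formDominated_form_comp_iff {V : Type*} [AddCommGroup V] [Module ℝ V] {S : V →ₗ[ℝ] X.V}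
    {T : V →ₗ[ℝ] Y.V} {c : ℝ} (hc : 0 ≤ c) :
    FormDominated (X.form ∘ₗ S) (Y.form ∘ₗ T) c ↔
      ∀ (n : ℕ) (a : Matrix (Fin n) (Fin n) V), Y.matNorm (a.map T) ≤ c * X.matNorm (a.map S) := by
  refine ⟨fun h n a => ?_, fun h ι κ _ _ a ha => ?_⟩
  · rw [mul_comm]
    have hC := OperatorSpace.matNorm_nonneg (a.map S)
    exact (OperatorSpace.matNorm_le_iff (mul_nonneg hC hc)).mpr <|
      h.formBound hC ((OperatorSpace.matNorm_le_iff hC).mp le_rfl)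
  · let e := (Fintype.equivFin (ι ⊕ κ)).symm
    let b : Matrix _ _ V := (Matrix.fromBlocks 0 a 0 0).submatrix e e
    have hb : FormBound (X.form ∘ₗ S) b 1 :=
      ((formBound_fromBlocks_corner zero_le_one).mpr ha).submatrix e e
    have hTb : FormBound (Y.form ∘ₗ T) b c := (OperatorSpace.matNorm_le_iff hc).mp <|
      (h _ b).trans (mul_le_of_le_one_right hc ((OperatorSpace.matNorm_le_iff zero_le_one).mpr hb))
    exact (formBound_fromBlocks_corner hc).mp ((formBound_submatrix e e).mp hTb)

theorem completelyBoundedBy_iff_formDominated {T : X.V →ₗ[ℝ] Y.V} {c : ℝ} (hc : 0 ≤ c) :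
    CompletelyBoundedBy T c ↔ FormDominated X.form (Y.form ∘ₗ T) c :=
  (formDominated_form_comp_iff (S := LinearMap.id) hc).symm

theorem completelyContractive_iff_formDominated {T : X.V →ₗ[ℝ] Y.V} :
    CompletelyContractive T ↔ FormDominated X.form (Y.form ∘ₗ T) 1 := by
  rw [← completelyBoundedBy_one_iff, completelyBoundedBy_iff_formDominated zero_le_one]

theorem CompletelyContractive.comp {S : Y.V → Z.V} {T : X.V → Y.V} (hS : CompletelyContractive S)
    (hT : CompletelyContractive T) : CompletelyContractive (S ∘ T) := fun n a => by
  rw [← Matrix.map_map]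
  exact (hS n _).trans (hT n a)

end CompletelyBounded

/-! ### Linearity -/

section Linear

theorem algebraMap_ofReal {F E : Type*} [RCLike F] [RCLike E] [NormedAlgebra F E] (r : ℝ) :
    algebraMap F E (r : F) = (r : E) := by
  have := map_real_smul (algebraMap F E) (continuous_algebraMap F E) r 1
  rwa [map_one, RCLike.real_smul_eq_coe_mul, RCLike.real_smul_eq_coe_mul, mul_one, mul_one] at this

theorem map_algebraMap_smul_of_map_I_smul {F E M N : Type*} [RCLike F] [RCLike E]
    [NormedAlgebra F E] [AddCommGroup M] [Module ℝ M] [Module E M] [IsScalarTower ℝ E M]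
    [AddCommGroup N] [Module ℝ N] [Module E N] [IsScalarTower ℝ E N] (T : M →ₗ[ℝ] N)
    (h : ∀ x, T (algebraMap F E RCLike.I • x) = algebraMap F E RCLike.I • T x) (c : F) (x : M) :
    T (algebraMap F E c • x) = algebraMap F E c • T x := by
  have map_ofReal (r : ℝ) (x : M) : T ((r : E) • x) = (r : E) • T x := by
    rw [← RCLike.algebraMap_eq_ofReal, algebraMap_smul, algebraMap_smul, T.map_smul]
  rw [← RCLike.re_add_im c, map_add, map_mul, algebraMap_ofReal, algebraMap_ofReal, add_smul,
    add_smul, mul_smul, mul_smul, T.map_add, map_ofReal, map_ofReal, h]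

variable {𝕜 : Type} [RCLike 𝕜] {F₂ : Type} [RCLike F₂] [NormedAlgebra F₂ 𝕜]
  {X Y Z : OperatorSpace.{u} 𝕜} {T : X.V → Y.V}

namespace IsLinearOver

/-- An `F₂`-linear map as a bundled real-linear map. -/
@[simps]
def toRealLinear (h : IsLinearOver F₂ T) : X.V →ₗ[ℝ] Y.V where
  toFun := T
  map_add' := h.map_add
  map_smul' c x := by
    have := h.map_smul (c : F₂) x
    rwa [algebraMap_ofReal] at this

theorem comp {S : Y.V → Z.V} (hS : IsLinearOver F₂ S) (hT : IsLinearOver F₂ T) :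
    IsLinearOver F₂ (S ∘ T) :=
  ⟨fun x y => by simp [hT.map_add, hS.map_add], fun c x => by simp [hT.map_smul, hS.map_smul]⟩

theorem of_linearMap (T : X.V →ₗ[𝕜] Y.V) : IsLinearOver (X := X) (Y := Y) F₂ T :=
  ⟨T.map_add, fun _ => T.map_smul _⟩

theorem of_map_I_smul (T : X.V →ₗ[ℝ] Y.V)
    (h : ∀ x, T (algebraMap F₂ 𝕜 RCLike.I • x) = algebraMap F₂ 𝕜 RCLike.I • T x) :
    IsLinearOver F₂ T :=
  ⟨T.map_add, map_algebraMap_smul_of_map_I_smul T h⟩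

end IsLinearOver

theorem CompletelyBoundedBy.norm_le {c : ℝ} (h : CompletelyBoundedBy T c) (x : X.V) :
    ‖Y.toOp (T x)‖ ≤ c * ‖X.toOp x‖ := by
  rw [OperatorSpace.norm_toOp_eq_matNorm, OperatorSpace.norm_toOp_eq_matNorm]
  exact h 1 _

theorem CompletelyIsometric.norm_eq (h : CompletelyIsometric T) (x : X.V) :
    ‖Y.toOp (T x)‖ = ‖X.toOp x‖ := by
  rw [OperatorSpace.norm_toOp_eq_matNorm, OperatorSpace.norm_toOp_eq_matNorm]
  exact h 1 _

theorem CompletelyIsometric.injective (h : CompletelyIsometric T) (hT : IsLinearOver F₂ T) :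
    Function.Injective T := by
  refine (injective_iff_map_eq_zero hT.toRealLinear).mpr fun x (hx : T x = 0) => ?_
  have norm_x := h.norm_eq x
  rw [hx, map_zero, norm_zero, eq_comm, norm_eq_zero] at norm_x
  exact X.toOp_injective (norm_x.trans X.toOp.map_zero.symm)

end Linear

/-! ### Unital maps: complete positivity and complete contractivity -/

section Positive

variable {A K : Type*} [AddCommGroup A] [Module ℝ A] [NormedAddCommGroup K] [InnerProductSpace ℝ K]
  {ι ι' : Type*} [Fintype ι] [Fintype ι'] {β : A →ₗ[ℝ] K →ₗ[ℝ] K →ₗ[ℝ] ℝ} {a : Matrix ι ι A}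

/-- The matrix of forms `β (a i j)` is accretive. -/
def FormAccretive (β : A →ₗ[ℝ] K →ₗ[ℝ] K →ₗ[ℝ] ℝ) (a : Matrix ι ι A) : Prop :=
  ∀ v, 0 ≤ trilinearSum β a v v

/-- The matrix of forms `β (a i j)` is positive, that is, symmetric and accretive. -/
def FormPos (β : A →ₗ[ℝ] K →ₗ[ℝ] K →ₗ[ℝ] ℝ) (a : Matrix ι ι A) : Prop :=
  (∀ w v, trilinearSum β a w v = trilinearSum β a v w) ∧ FormAccretive β a

theorem FormAccretive.submatrix (h : FormAccretive β a) (e : ι' ≃ ι) :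
    FormAccretive β (a.submatrix e e) := fun v => by
  rw [trilinearSum_submatrix]
  exact h _

theorem FormPos.submatrix (h : FormPos β a) (e : ι' ≃ ι) : FormPos β (a.submatrix e e) := by
  refine ⟨fun w v => ?_, h.2.submatrix e⟩
  rw [trilinearSum_submatrix, trilinearSum_submatrix]
  exact h.1 _ _

theorem formAccretive_fromBlocks_skew_iff :
    FormAccretive β (Matrix.fromBlocks 0 a (-a) 0) ↔
      ∀ w v, trilinearSum β a w v = trilinearSum β a v w := by
  have skew (w v : ι → K) : trilinearSum β (Matrix.fromBlocks 0 a (-a) 0) (Sum.elim w v)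
      (Sum.elim w v) = trilinearSum β a w v - trilinearSum β a v w := by
    have : trilinearSum β (-a) v w = -trilinearSum β a v w := by
      simpa using trilinearSum_smul β (-1) a v w
    rw [trilinearSum_fromBlocks, this]
    simp [sub_eq_add_neg]
  refine ⟨fun h w v => le_antisymm ?_ ?_, fun h v => ?_⟩
  · exact sub_nonneg.mp (skew v w ▸ h _)
  · exact sub_nonneg.mp (skew w v ▸ h _)
  · rw [← Sum.elim_comp_inl_inr v, skew, h, sub_self]

theorem formPos_iff_formAccretive :
    FormPos β a ↔ FormAccretive β (Matrix.fromBlocks 0 a (-a) 0) ∧ FormAccretive β a := by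
  rw [formAccretive_fromBlocks_skew_iff, FormPos]

theorem trilinearSum_sub (b : Matrix ι ι A) (w v : ι → K) :
    trilinearSum β (a - b) w v = trilinearSum β a w v - trilinearSum β b w v := by
  simp [trilinearSum]

theorem trilinearSum_neg_left (w v : ι → K) : trilinearSum β a (-w) v = -trilinearSum β a w v := by
  simp [trilinearSum]

theorem trilinearSum_diagonal [DecidableEq ι] {e : A} (he : ∀ w v, β e w v = inner ℝ w v)
    (w v : ι → K) :
    trilinearSum β (Matrix.diagonal fun _ => e) w v = ∑ i, inner ℝ (w i) (v i) := by
  simp [trilinearSum, Matrix.diagonal_apply, apply_ite, ite_apply, he]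

theorem formAccretive_of_formBound_diagonal_sub [DecidableEq ι] {e : A}
    (he : ∀ w v, β e w v = inner ℝ w v) {C : ℝ}
    (h : ∀ t : ℝ, 0 < t → FormBound β ((Matrix.diagonal fun _ => e) - t • a) (1 + C * t ^ 2)) :
    FormAccretive β a := fun v => by
  have bound (t : ℝ) (ht : t ∈ Set.Ioi (0 : ℝ)) :
      0 ≤ trilinearSum β a v v + C * t * ∑ i, ‖v i‖ ^ 2 := by
    have := h t ht v v
    rw [trilinearSum_sub, trilinearSum_smul, trilinearSum_diagonal he, add_self_div_two] at this
    simp only [real_inner_self_eq_norm_sq, smul_eq_mul] at this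
    refine le_of_mul_le_mul_left ?_ ht
    linarith
  have cont : Continuous fun t : ℝ => trilinearSum β a v v + C * t * ∑ i, ‖v i‖ ^ 2 := by
    fun_prop
  simpa using ge_of_tendsto ((cont.tendsto 0).mono_left nhdsWithin_le_nhds)
    (Filter.eventually_of_mem self_mem_nhdsWithin bound)

theorem formPos_fromBlocks_smul_diagonal_iff [DecidableEq ι] {e : A}
    (he : ∀ w v, β e w v = inner ℝ w v) {C : ℝ} {b : Matrix ι ι A} :
    FormPos β (Matrix.fromBlocks (C • Matrix.diagonal fun _ => e) a b
        (C • Matrix.diagonal fun _ => e)) ↔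
      FormBound β a C ∧ ∀ w v, trilinearSum β b w v = trilinearSum β a v w := by
  have block_value (w w' v v' : ι → K) :
      trilinearSum β (Matrix.fromBlocks (C • Matrix.diagonal fun _ => e) a b
          (C • Matrix.diagonal fun _ => e)) (Sum.elim w w') (Sum.elim v v') =
        (C * ∑ i, inner ℝ (w i) (v i) + trilinearSum β a w v') +
          (trilinearSum β b w' v + C * ∑ i, inner ℝ (w' i) (v' i)) := by
    simp only [trilinearSum_fromBlocks, trilinearSum_smul, trilinearSum_diagonal he, smul_eq_mul]
  constructor
  · rintro ⟨symm, nonneg⟩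
    have hb (w v : ι → K) : trilinearSum β b w v = trilinearSum β a v w := by
      have := symm (Sum.elim 0 w) (Sum.elim v 0)
      rw [block_value, block_value] at this
      simpa [trilinearSum] using this
    refine ⟨fun w v => ?_, hb⟩
    have := nonneg (Sum.elim (-w) v)
    rw [block_value, hb] at this
    simp only [trilinearSum_neg_left, Pi.neg_apply, inner_neg_neg,
      real_inner_self_eq_norm_sq] at this
    linarith
  · rintro ⟨ha, hb⟩
    refine ⟨fun w v => ?_, fun v => ?_⟩
    · rw [← Sum.elim_comp_inl_inr w, ← Sum.elim_comp_inl_inr v, block_value, block_value, hb, hb]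
      simp only [real_inner_comm (w _), Function.comp_apply]
      ring
    · rw [← Sum.elim_comp_inl_inr v, block_value, hb]
      have := ha (-(v ∘ Sum.inl)) (v ∘ Sum.inr)
      rw [trilinearSum_neg_left] at this
      simp only [Pi.neg_apply, norm_neg] at this
      simp only [real_inner_self_eq_norm_sq]
      linarith

theorem norm_sub_smul_le {E : Type*} [NormedAddCommGroup E] [InnerProductSpace ℝ E] {v y : E}
    {C t : ℝ} (h : 0 ≤ inner ℝ v y) (hy : ‖y‖ ≤ C * ‖v‖) (ht : 0 ≤ t) :
    ‖v - t • y‖ ≤ (1 + C ^ 2 * t ^ 2) * ‖v‖ := by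
  have norm_sq : ‖v - t • y‖ ^ 2 = ‖v‖ ^ 2 - 2 * (t * inner ℝ v y) + t ^ 2 * ‖y‖ ^ 2 := by
    rw [norm_sub_sq_real, real_inner_smul_right, norm_smul, mul_pow, Real.norm_eq_abs, sq_abs]
  refine abs_le_of_sq_le_sq' ?_ (by positivity) |>.2
  calc ‖v - t • y‖ ^ 2
    _ ≤ ‖v‖ ^ 2 + t ^ 2 * (C * ‖v‖) ^ 2 := by
        rw [norm_sq]
        gcongr
        linarith [mul_nonneg ht h]
    _ ≤ ((1 + C ^ 2 * t ^ 2) * ‖v‖) ^ 2 := by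
        have : 0 ≤ (C ^ 2 * t ^ 2 + (C ^ 2 * t ^ 2) ^ 2) * ‖v‖ ^ 2 := by positivity
        linarith

variable {𝕜 : Type} [RCLike 𝕜] {X Y : OperatorSpace.{u} 𝕜}

theorem isSymmetric_of_re_inner {E : Type*} [NormedAddCommGroup E] [InnerProductSpace 𝕜 E]
    {S : E →ₗ[𝕜] E}
    (h : ∀ w v, RCLike.re (inner 𝕜 (S w) v) = RCLike.re (inner 𝕜 w (S v))) : S.IsSymmetric := by
  refine fun w v => RCLike.ext (h w v) ?_
  have := h ((RCLike.I : 𝕜) • w) v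
  simpa [inner_smul_left] using this

theorem matPos_iff_formPos {n : ℕ} {a : Matrix (Fin n) (Fin n) X.V} :
    X.MatPos a ↔ FormPos X.form a := by
  constructor
  · rintro ⟨symm, nonneg⟩
    refine ⟨fun w v => ?_, fun v => ?_⟩
    · have := congrArg RCLike.re (symm (WithLp.toLp 2 w) (WithLp.toLp 2 v))
      rw [OperatorSpace.re_inner_eq_real_inner, OperatorSpace.re_inner_eq_real_inner,
        real_inner_comm] at this
      simpa only [ContinuousLinearMap.coe_coe, OperatorSpace.inner_mat] using this.symm
    · have := nonneg (WithLp.toLp 2 v)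
      rwa [ContinuousLinearMap.reApplyInnerSelf_apply, OperatorSpace.re_inner_eq_real_inner,
        real_inner_comm, OperatorSpace.inner_mat] at this
  · rintro ⟨symm, nonneg⟩
    refine ⟨isSymmetric_of_re_inner fun w v => ?_, fun v => ?_⟩
    · rw [OperatorSpace.re_inner_eq_real_inner, OperatorSpace.re_inner_eq_real_inner,
        real_inner_comm]
      simpa only [ContinuousLinearMap.coe_coe, OperatorSpace.inner_mat] using symm _ _
    · rw [ContinuousLinearMap.reApplyInnerSelf_apply, OperatorSpace.re_inner_eq_real_inner,
        real_inner_comm, OperatorSpace.inner_mat]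
      exact nonneg _

theorem OperatorSpace.form_unit {e : X.V} (he : X.toOp e = 1) (w v : X.H) :
    X.form e w v = inner ℝ w v := by
  rw [form_apply, he, one_apply_eq_self]

theorem FormAccretive.formBound_diagonal_sub {e : X.V} (he : X.toOp e = 1) {n : ℕ}
    {a : Matrix (Fin n) (Fin n) X.V} (ha : FormAccretive X.form a) {t : ℝ} (ht : 0 ≤ t) :
    FormBound X.form ((Matrix.diagonal fun _ => e) - t • a) (1 + X.matNorm a ^ 2 * t ^ 2) := by
  intro w v
  let w' := WithLp.toLp 2 w
  let v' := WithLp.toLp 2 v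
  have accretive : 0 ≤ inner ℝ v' (X.mat a v') := by
    rw [OperatorSpace.inner_mat]
    exact ha v
  calc trilinearSum X.form ((Matrix.diagonal fun _ => e) - t • a) w v
    _ = inner ℝ w' (v' - t • X.mat a v') := by
        rw [trilinearSum_sub, trilinearSum_smul, trilinearSum_diagonal (X.form_unit he),
          inner_sub_right, real_inner_smul_right, OperatorSpace.inner_mat, PiLp.inner_apply]
        rfl
    _ ≤ ‖w'‖ * ((1 + X.matNorm a ^ 2 * t ^ 2) * ‖v'‖) :=
        (real_inner_le_norm _ _).trans <| mul_le_mul_of_nonneg_left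
          (norm_sub_smul_le accretive ((X.mat a).le_opNorm v') ht) (norm_nonneg _)
    _ ≤ (1 + X.matNorm a ^ 2 * t ^ 2) * ((‖w'‖ ^ 2 + ‖v'‖ ^ 2) / 2) := by
        have : 0 ≤ (1 + X.matNorm a ^ 2 * t ^ 2) * (‖w'‖ - ‖v'‖) ^ 2 := by positivity
        linarith
    _ = _ := by rw [PiLp.norm_sq_eq_of_L2, PiLp.norm_sq_eq_of_L2]

theorem FormDominated.formAccretive {T : X.V →ₗ[ℝ] Y.V} {e : X.V} (he : X.toOp e = 1)
    (hTe : Y.toOp (T e) = 1) (hT : FormDominated X.form (Y.form ∘ₗ T) 1) {ι : Type} [Fintype ι]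
    {a : Matrix ι ι X.V} (ha : FormAccretive X.form a) : FormAccretive (Y.form ∘ₗ T) a := by
  let f := Fintype.equivFin ι
  have : FormAccretive (Y.form ∘ₗ T) (a.submatrix f.symm f.symm) := by
    refine formAccretive_of_formBound_diagonal_sub (Y.form_unit hTe)
      (C := X.matNorm (a.submatrix f.symm f.symm) ^ 2) fun t ht => ?_
    simpa using hT.formBound (by positivity)
      ((ha.submatrix f.symm).formBound_diagonal_sub he ht.le)
  simpa using this.submatrix f

theorem completelyPositive_iff_forall_formPos {T : X.V →ₗ[ℝ] Y.V} :
    CompletelyPositive T ↔ ∀ ⦃ι : Type⦄ [Fintype ι] ⦃a : Matrix ι ι X.V⦄,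
      FormPos X.form a → FormPos (Y.form ∘ₗ T) a := by
  refine ⟨fun h ι _ a ha => ?_, fun h n a ha => ?_⟩
  · let f := Fintype.equivFin ι
    have pos : FormPos (Y.form ∘ₗ T) (a.submatrix f.symm f.symm) :=
      matPos_iff_formPos.mp (h _ _ (matPos_iff_formPos.mpr (ha.submatrix f.symm)))
    simpa using pos.submatrix f
  · exact matPos_iff_formPos.mpr (h (matPos_iff_formPos.mp ha))

theorem CompletelyContractive.completelyPositive {T : X.V →ₗ[ℝ] Y.V} (hX : X.IsUnital)
    (hT : MapsUnit T) (h : CompletelyContractive T) : CompletelyPositive T := by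
  obtain ⟨e, he⟩ := hX
  rw [completelyContractive_iff_formDominated] at h
  refine completelyPositive_iff_forall_formPos.mpr fun ι _ a ha => ?_
  rw [formPos_iff_formAccretive] at ha ⊢
  exact ha.imp (h.formAccretive he (hT e he)) (h.formAccretive he (hT e he))

theorem OperatorSpace.form_of_toOp_eq_star {x y : X.V} (h : X.toOp y = star (X.toOp x))
    (w v : X.H) : X.form y w v = X.form x v w := by
  rw [form_apply, form_apply, h, real_inner_comm]
  exact congrArg RCLike.re (ContinuousLinearMap.adjoint_inner_left (X.toOp x) w v)

theorem CompletelyPositive.completelyContractive {T : X.V →ₗ[ℝ] Y.V} (hX : X.IsSystem)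
    (hT : MapsUnit T) (h : CompletelyPositive T) : CompletelyContractive T := by
  obtain ⟨⟨e, he⟩, exists_adjoint⟩ := hX
  choose adj toOp_adj using exists_adjoint
  intro n a
  have symm (w v : Fin n → X.H) :
      trilinearSum X.form (a.transpose.map adj) w v = trilinearSum X.form a v w := by
    simpa [trilinearSum, OperatorSpace.form_of_toOp_eq_star (toOp_adj _)] using Finset.sum_comm
  have bound : FormBound X.form a (X.matNorm a) :=
    (OperatorSpace.matNorm_le_iff (OperatorSpace.matNorm_nonneg a)).mp le_rfl
  have pos := completelyPositive_iff_forall_formPos.mp h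
    ((formPos_fromBlocks_smul_diagonal_iff (X.form_unit he)).mpr ⟨bound, symm⟩)
  exact (OperatorSpace.matNorm_le_iff (OperatorSpace.matNorm_nonneg a)).mpr
    ((formPos_fromBlocks_smul_diagonal_iff (β := Y.form ∘ₗ T) (Y.form_unit (hT e he))).mp pos).1

end Positive

/-! ### Extension of completely bounded maps into `B(H)` -/

section Wittstock

open RCLike

variable {𝕜 : Type} [RCLike 𝕜]

namespace OperatorSpace

variable {X : OperatorSpace.{u} 𝕜}

theorem form_injective : Function.Injective X.form := fun _ _ h => X.toOp_injective <|
  ContinuousLinearMap.ext fun v => ext_inner_left ℝ fun w => congrArg (fun f => f w v) h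

theorem inner_smul_right_eq_inner_conj_smul (z : 𝕜) (w v : X.H) :
    inner ℝ w (z • v) = inner ℝ (starRingEnd 𝕜 z • w) v := by
  change re (inner 𝕜 w (z • v)) = re (inner 𝕜 (starRingEnd 𝕜 z • w) v)
  rw [inner_smul_right, inner_smul_left, conj_conj]

theorem form_smul (z : 𝕜) (x : X.V) (w v : X.H) :
    X.form (z • x) w v = X.form x (starRingEnd 𝕜 z • w) v := by
  rw [form_apply, form_apply, map_smul, smul_apply, inner_smul_right_eq_inner_conj_smul]

theorem form_smul_right (z : 𝕜) (x : X.V) (w v : X.H) :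
    X.form x w (z • v) = X.form x (starRingEnd 𝕜 z • w) v := by
  rw [form_apply, form_apply, map_smul, inner_smul_right_eq_inner_conj_smul]

end OperatorSpace

/-- The operator space `B(H)`. -/
def fullSpace (𝕜 : Type) [RCLike 𝕜] (H : Type u) [NormedAddCommGroup H] [InnerProductSpace 𝕜 H]
    [CompleteSpace H] : OperatorSpace.{u} 𝕜 where
  V := H →L[𝕜] H
  H := H
  toOp := LinearMap.id
  toOp_injective := Function.injective_id

section Riesz

variable {H : Type u} [NormedAddCommGroup H] [InnerProductSpace 𝕜 H] [CompleteSpace H]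

theorem exists_form_fullSpace_eq {f : (fullSpace 𝕜 H).H →ₗ[ℝ] (fullSpace 𝕜 H).H →ₗ[ℝ] ℝ} {C : ℝ}
    (hC : ∀ w v, f w v ≤ C * (‖w‖ * ‖v‖))
    (hI : ∀ w v, f w ((I : 𝕜) • v) = -f ((I : 𝕜) • w) v) :
    ∃ S, (fullSpace 𝕜 H).form S = f := by
  let f' : (fullSpace 𝕜 H).H →ₗ⋆[ℝ] (fullSpace 𝕜 H).H →ₗ[ℝ] ℝ :=
    { f.flip with map_smul' := f.flip.map_smul }
  have norm_f' (v w) : ‖f' v w‖ ≤ C * ‖v‖ * ‖w‖ := by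
    rw [Real.norm_eq_abs, abs_le', mul_assoc, mul_comm ‖v‖]
    refine ⟨hC w v, ?_⟩
    simpa [f'] using hC (-w) v
  let S := InnerProductSpace.continuousLinearMapOfBilin (f'.mkContinuous₂ C norm_f')
  have inner_S (w v : (fullSpace 𝕜 H).H) : inner ℝ w (S v) = f w v := by
    rw [real_inner_comm, InnerProductSpace.continuousLinearMapOfBilin_apply]
    rfl
  have map_I_smul (v : (fullSpace 𝕜 H).H) : S ((I : 𝕜) • v) = (I : 𝕜) • S v :=
    ext_inner_left ℝ fun w => by
      rw [OperatorSpace.inner_smul_right_eq_inner_conj_smul, inner_S, hI, conj_I, neg_smul,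
        inner_neg_left, inner_S]
  have map_smul := map_algebraMap_smul_of_map_I_smul (F := 𝕜) S.toLinearMap map_I_smul
  exact ⟨{ S with map_smul' := map_smul }, LinearMap.ext₂ inner_S⟩

end Riesz

section Average

/-- The average of `g` and its transform by the scalars `p`, `q`, `r`, used to make `g` invariant
under this transformation. -/
def averageForm {S V K : Type*} [AddCommGroup V] [DistribSMul S V] [Module ℝ V]
    [SMulCommClass S ℝ V] [AddCommGroup K] [DistribSMul S K] [Module ℝ K] [SMulCommClass S ℝ K]
    (p q r : S) (g : V →ₗ[ℝ] K →ₗ[ℝ] K →ₗ[ℝ] ℝ) : V →ₗ[ℝ] K →ₗ[ℝ] K →ₗ[ℝ] ℝ where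
  toFun b := (2⁻¹ : ℝ) • (g b +
    (g (p • b)).compl₁₂ (DistribSMul.toLinearMap ℝ K q) (DistribSMul.toLinearMap ℝ K r))
  map_add' b b' := by
    ext
    simp
    ring
  map_smul' t b := by
    ext
    simp [smul_comm p t]
    ring

theorem averageForm_apply {S V K : Type*} [AddCommGroup V] [DistribSMul S V] [Module ℝ V]
    [SMulCommClass S ℝ V] [AddCommGroup K] [DistribSMul S K] [Module ℝ K] [SMulCommClass S ℝ K]
    (p q r : S) (g : V →ₗ[ℝ] K →ₗ[ℝ] K →ₗ[ℝ] ℝ) (b : V) (h k : K) :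
    averageForm p q r g b h k = 2⁻¹ * (g b h k + g (p • b) (q • h) (r • k)) := rfl

variable {A B Z : OperatorSpace.{u} 𝕜} {κ : A.V →ₗ[ℝ] B.V} {φ : A.V →ₗ[ℝ] Z.V} {c : ℝ}
  {g : B.V →ₗ[ℝ] Z.H →ₗ[ℝ] Z.H →ₗ[ℝ] ℝ}

theorem FormBound.smul_of_norm_eq_one {ι ι' : Type*} [Fintype ι] [Fintype ι']
    {b : Matrix ι ι' B.V} {C : ℝ} (hb : FormBound B.form b C) {p : 𝕜} (hp : ‖p‖ = 1) :
    FormBound B.form (p • b) C := fun w v => by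
  simpa [trilinearSum, OperatorSpace.form_smul, norm_smul, hp]
    using hb (fun i => starRingEnd 𝕜 p • w i) v

/-- `g` restricts to the forms of `φ` along `κ` and is dominated by `c` times the forms of `B`. -/
structure IsFormExtension (κ : A.V →ₗ[ℝ] B.V) (φ : A.V →ₗ[ℝ] Z.V) (c : ℝ)
    (g : B.V →ₗ[ℝ] Z.H →ₗ[ℝ] Z.H →ₗ[ℝ] ℝ) : Prop where
  comp_eq : g ∘ₗ κ = Z.form ∘ₗ φ
  formDominated : FormDominated B.form g c

namespace IsFormExtension

theorem averageForm (hg : IsFormExtension κ φ c g) {p q r : 𝕜} (hp : ‖p‖ = 1)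
    (hq : ‖q‖ = 1) (hr : ‖r‖ = 1) (hpqr : starRingEnd 𝕜 q * (p * r) = 1)
    (hκ : ∀ a, κ (p • a) = p • κ a) (hφ : ∀ a, φ (p • a) = p • φ a) :
    IsFormExtension κ φ c (averageForm p q r g) where
  comp_eq := by
    have g_comp (a : A.V) : g (κ a) = Z.form (φ a) := LinearMap.congr_fun hg.comp_eq a
    ext a h k
    have invariant : Z.form (p • φ a) (q • h) (r • k) = Z.form (φ a) h k := by
      rw [OperatorSpace.form_smul, OperatorSpace.form_smul_right, smul_smul, smul_smul,
        ← map_mul, ← conj_conj q, ← map_mul, mul_comm r, mul_comm, hpqr, map_one, one_smul]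
    simp only [LinearMap.comp_apply, averageForm_apply]
    rw [← hκ, g_comp, g_comp, hφ, invariant]
    ring
  formDominated ι ι' _ _ b hb w v := by
    have bound := hg.formDominated b hb w v
    have bound' := hg.formDominated _ (hb.smul_of_norm_eq_one hp) (q • w) (r • v)
    simp only [trilinearSum, Pi.smul_apply, Matrix.smul_apply, norm_smul, hq, hr, one_mul]
      at bound bound'
    simp only [trilinearSum, averageForm_apply, ← Finset.mul_sum, Finset.sum_add_distrib]
    linarith

end IsFormExtension

theorem norm_eq_one_of_mul_self_eq_neg_one {z : 𝕜} (h : z * z = -1) : ‖z‖ = 1 := by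
  have : ‖z‖ * ‖z‖ = 1 := by rw [← norm_mul, h, norm_neg, norm_one]
  nlinarith [norm_nonneg z]

theorem conj_mul_self_of_mul_self_eq_neg_one {z : 𝕜} (h : z * z = -1) :
    starRingEnd 𝕜 z * z = 1 := by
  rw [RCLike.conj_mul, norm_eq_one_of_mul_self_eq_neg_one h, ofReal_one, one_pow]

theorem conj_eq_neg_of_mul_self_eq_neg_one {z : 𝕜} (h : z * z = -1) : starRingEnd 𝕜 z = -z :=
  calc starRingEnd 𝕜 z
    _ = -(starRingEnd 𝕜 z * (z * z)) := by rw [h, mul_neg_one, neg_neg]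
    _ = -z := by rw [← mul_assoc, conj_mul_self_of_mul_self_eq_neg_one h, one_mul]

namespace IsFormExtension

theorem exists_I_smul_right (hg : IsFormExtension κ φ c g) :
    ∃ g', IsFormExtension κ φ c g' ∧
      ∀ b h k, g' b h ((I : 𝕜) • k) = -g' b ((I : 𝕜) • h) k := by
  rcases I_mul_I (K := 𝕜) with hI | hI
  · exact ⟨g, hg, by simp [hI]⟩
  have norm_I := norm_eq_one_of_mul_self_eq_neg_one hI
  refine ⟨_, hg.averageForm (p := 1) norm_one norm_I norm_I ?_ (by simp) (by simp),
    fun b h k => ?_⟩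
  · rw [one_mul, conj_mul_self_of_mul_self_eq_neg_one hI]
  · simp only [averageForm_apply, smul_smul, hI, neg_smul, one_smul, map_neg, LinearMap.neg_apply]
    ring

theorem exists_smul_left (hg : IsFormExtension κ φ c g)
    (hI : ∀ b h k, g b h ((I : 𝕜) • k) = -g b ((I : 𝕜) • h) k) {z : 𝕜} (hz : z = 0 ∨ z * z = -1)
    (hκ : ∀ a, κ (z • a) = z • κ a) (hφ : ∀ a, φ (z • a) = z • φ a) :
    ∃ g', IsFormExtension κ φ c g' ∧
      (∀ b h k, g' b h ((I : 𝕜) • k) = -g' b ((I : 𝕜) • h) k) ∧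
      ∀ b h k, g' (z • b) h k = -g' b (z • h) k := by
  rcases hz with hz | hz
  · exact ⟨g, hg, hI, by simp [hz]⟩
  have norm_z := norm_eq_one_of_mul_self_eq_neg_one hz
  refine ⟨_, hg.averageForm (r := 1) norm_z norm_z norm_one ?_ hκ hφ, fun b h k => ?_,
    fun b h k => ?_⟩
  · rw [mul_one, conj_mul_self_of_mul_self_eq_neg_one hz]
  · simp only [averageForm_apply, one_smul, hI, smul_comm z (I : 𝕜)]
    ring
  · simp only [averageForm_apply, smul_smul, hz, neg_smul, one_smul, map_neg, LinearMap.neg_apply]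
    ring

end IsFormExtension

end Average

section CbInjective

variable {F₂ : Type} [RCLike F₂] [NormedAlgebra F₂ 𝕜]

/-- Every completely bounded `F₂`-linear map into `Z` extends, with the same bound, along
`F₂`-linear complete isometries. -/
def IsCbInjective (F₂ : Type) [RCLike F₂] [NormedAlgebra F₂ 𝕜] (Z : OperatorSpace.{u} 𝕜) : Prop :=
  ∀ ⦃A B : OperatorSpace.{u} 𝕜⦄ ⦃κ : A.V → B.V⦄, IsLinearOver F₂ κ → CompletelyIsometric κ →
    ∀ ⦃φ : A.V → Z.V⦄, IsLinearOver F₂ φ → ∀ ⦃c : ℝ⦄, 0 ≤ c → CompletelyBoundedBy φ c →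
    ∃ ψ : B.V → Z.V, IsLinearOver F₂ ψ ∧ CompletelyBoundedBy ψ c ∧ ∀ a, ψ (κ a) = φ a

theorem algebraMap_I_eq_zero_or_mul_self :
    algebraMap F₂ 𝕜 I = 0 ∨ algebraMap F₂ 𝕜 I * algebraMap F₂ 𝕜 I = -1 := by
  refine (I_mul_I (K := F₂)).imp (fun h => by rw [h, map_zero]) fun h => ?_
  rw [← map_mul, h, map_neg, map_one]

theorem conj_algebraMap_I : starRingEnd 𝕜 (algebraMap F₂ 𝕜 I) = -algebraMap F₂ 𝕜 I := by
  rcases algebraMap_I_eq_zero_or_mul_self (𝕜 := 𝕜) (F₂ := F₂) with h | h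
  · rw [h, map_zero, neg_zero]
  · exact conj_eq_neg_of_mul_self_eq_neg_one h

/-- The theorem of Wittstock and Paulsen. The first averaging makes the extended form the form of an
operator, the second one makes the extension `F₂`-linear. -/
theorem isCbInjective_fullSpace {H : Type u} [NormedAddCommGroup H] [InnerProductSpace 𝕜 H]
    [CompleteSpace H] : IsCbInjective F₂ (fullSpace 𝕜 H) := by
  intro A B κ hκ isometric φ hφ c hc bounded
  have dominated : FormDominated (B.form ∘ₗ hκ.toRealLinear)
      ((fullSpace 𝕜 H).form ∘ₗ hφ.toRealLinear) c :=
    (formDominated_form_comp_iff hc).mpr fun n a =>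
      (bounded n a).trans_eq (congrArg (c * ·) (isometric n a).symm)
  obtain ⟨g₀, comp_eq, formDominated⟩ := dominated.exists_extension OperatorSpace.boundedForms_form
    (isometric.injective hκ) hc
  obtain ⟨g₁, hg₁, hI₁⟩ := (IsFormExtension.mk comp_eq formDominated).exists_I_smul_right
  obtain ⟨g, hg, hI, hI'⟩ := hg₁.exists_smul_left hI₁ (algebraMap_I_eq_zero_or_mul_self (F₂ := F₂))
    (hκ.map_smul I) (hφ.map_smul I)
  have exists_operator (b : B.V) : ∃ S, (fullSpace 𝕜 H).form S = g b :=
    have ⟨_, hC⟩ := hg.formDominated.boundedForms OperatorSpace.boundedForms_form b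
    exists_form_fullSpace_eq hC (hI b)
  choose ψ₀ form_ψ₀ using exists_operator
  let ψ : B.V →ₗ[ℝ] (fullSpace 𝕜 H).V :=
    { toFun := ψ₀
      map_add' b b' := OperatorSpace.form_injective (by simp only [form_ψ₀, map_add])
      map_smul' t b := OperatorSpace.form_injective (by
        simp only [form_ψ₀, map_smul, RingHom.id_apply]) }
  have form_ψ : (fullSpace 𝕜 H).form ∘ₗ ψ = g := LinearMap.ext form_ψ₀
  refine ⟨ψ, .of_map_I_smul ψ fun b => OperatorSpace.form_injective ?_,
    (completelyBoundedBy_iff_formDominated hc).mpr (form_ψ ▸ hg.formDominated), fun a =>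
    OperatorSpace.form_injective ?_⟩
  · ext h k
    rw [OperatorSpace.form_smul, conj_algebraMap_I, neg_smul, map_neg, LinearMap.neg_apply]
    simp only [ψ, LinearMap.coe_mk, AddHom.coe_mk, form_ψ₀, hI']
  · exact (form_ψ₀ _).trans (LinearMap.congr_fun hg.comp_eq a)

end CbInjective

end Wittstock

/-! ### The operator space `ℓ^∞(G, X)` as a product -/

section EllInf

variable {𝕜 : Type} [RCLike 𝕜] {G : Type u} {X Z : OperatorSpace.{u} 𝕜}
  {F₂ : Type} [RCLike F₂] [NormedAlgebra F₂ 𝕜]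

/-- Evaluation of the elements of `ℓ^∞(G, X)` at `s`. -/
def coord (s : G) : (ellInf G X).V →ₗ[𝕜] X.V := LinearMap.proj s ∘ₗ (boundedFunctions G X).subtype

theorem ellInf_ext {f g : (ellInf G X).V} (h : ∀ s, coord s f = coord s g) : f = g :=
  Subtype.ext (funext h)

theorem hasSum_norm_sq_lp {H : Type*} [NormedAddCommGroup H] (w : lp (fun _ : G => H) 2) :
    HasSum (fun s => ‖w s‖ ^ 2) (‖w‖ ^ 2) := by
  simpa using lp.hasSum_norm (p := 2) (by norm_num) w

theorem hasSum_form_ellInf (f : (ellInf G X).V) (w v : lp (fun _ : G => X.H) 2) :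
    HasSum (fun s => X.form (coord s f) (w s) (v s)) ((ellInf G X).form f w v) :=
  RCLike.reCLM.hasSum (lp.hasSum_inner (𝕜 := 𝕜) w ((ellInf G X).toOp f v))

/-- The vector of `ℓ²(G, H)` supported at `s` with value `w`. -/
def single [DecidableEq G] (s : G) (w : X.H) : (ellInf G X).H :=
  lp.single (E := fun _ : G => X.H) 2 s w

theorem norm_single [DecidableEq G] (s : G) (w : X.H) : ‖single s w‖ = ‖w‖ :=
  lp.norm_single (E := fun _ : G => X.H) two_pos s w

theorem toOp_ellInf_single [DecidableEq G] (f : (ellInf G X).V) (s : G) (w : X.H) :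
    (ellInf G X).toOp f (single s w) = single s (X.toOp (coord s f) w) := by
  refine lp.ext (funext fun t => ?_)
  change X.toOp (coord t f) ((Pi.single s w : G → X.H) t) =
    (Pi.single s (X.toOp (coord s f) w) : G → X.H) t
  obtain rfl | h := eq_or_ne t s
  · rw [Pi.single_eq_same, Pi.single_eq_same]
  · rw [Pi.single_eq_of_ne h, Pi.single_eq_of_ne h, map_zero]

theorem form_ellInf_single [DecidableEq G] (f : (ellInf G X).V) (s : G) (w v : X.H) :
    (ellInf G X).form f (single s w) (single s v) = X.form (coord s f) w v := by
  rw [OperatorSpace.form_apply, toOp_ellInf_single]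
  refine (congrArg RCLike.re (lp.inner_single_left ..)).trans ?_
  rw [single, lp.single_apply_self]
  rfl

theorem single_injective [DecidableEq G] (s : G) :
    Function.Injective (single s : X.H → (ellInf G X).H) :=
  fun w v h => by simpa [single] using congrArg (fun u : lp (fun _ : G => X.H) 2 => u s) h

theorem formBound_ellInf_iff {ι κ : Type*} [Fintype ι] [Fintype κ]
    {a : Matrix ι κ (ellInf G X).V} {C : ℝ} :
    FormBound (ellInf G X).form a C ↔ ∀ s, FormBound X.form (a.map (coord s)) C := by
  classical
  refine ⟨fun h s w v => ?_,
    fun h (w : ι → lp (fun _ : G => X.H) 2) (v : κ → lp (fun _ : G => X.H) 2) => ?_⟩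
  · simpa only [trilinearSum, form_ellInf_single, norm_single] using!
      h (fun i => single s (w i)) fun j => single s (v j)
  · have hasSum_left : HasSum (fun s => trilinearSum X.form (a.map (coord s)) (w · s) (v · s))
        (trilinearSum (ellInf G X).form a w v) :=
      hasSum_sum fun i _ => hasSum_sum fun j _ => hasSum_form_ellInf (a i j) (w i) (v j)
    have hasSum_right : HasSum (fun s => C * ((∑ i, ‖w i s‖ ^ 2 + ∑ j, ‖v j s‖ ^ 2) / 2))
        (C * ((∑ i, ‖w i‖ ^ 2 + ∑ j, ‖v j‖ ^ 2) / 2)) :=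
      (((hasSum_sum fun i _ => hasSum_norm_sq_lp (w i)).add
        (hasSum_sum fun j _ => hasSum_norm_sq_lp (v j))).div_const 2).mul_left C
    exact hasSum_le (fun s => h s (w · s) (v · s)) hasSum_left hasSum_right

theorem matNorm_ellInf_le_iff {n : ℕ} {a : Matrix (Fin n) (Fin n) (ellInf G X).V} {C : ℝ}
    (hC : 0 ≤ C) : (ellInf G X).matNorm a ≤ C ↔ ∀ s, X.matNorm (a.map (coord s)) ≤ C := by
  simp only [OperatorSpace.matNorm_le_iff hC, formBound_ellInf_iff]

theorem toOp_ellInf_eq_one_iff {f : (ellInf G X).V} :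
    (ellInf G X).toOp f = 1 ↔ ∀ s, X.toOp (coord s f) = 1 := by
  classical
  refine ⟨fun h s => ?_, fun h => ?_⟩
  · refine ContinuousLinearMap.ext fun w => single_injective s ?_
    rw [← toOp_ellInf_single, h]
    rfl
  · refine ContinuousLinearMap.ext fun (v : lp (fun _ : G => X.H) 2) => lp.ext (funext fun s => ?_)
    exact congrArg (fun S => S (v s)) (h s)

theorem OperatorSpace.IsUnital.ellInf (hX : X.IsUnital) : (ellInf G X).IsUnital := by
  obtain ⟨e, he⟩ := hX
  exact ⟨⟨fun _ => e, ‖X.toOp e‖, fun _ => le_rfl⟩, toOp_ellInf_eq_one_iff.mpr fun _ => he⟩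

theorem OperatorSpace.IsSystem.ellInf (hX : X.IsSystem) : (ellInf G X).IsSystem := by
  refine ⟨hX.1.ellInf, fun f => ?_⟩
  choose adj toOp_adj using hX.2
  obtain ⟨C, hC⟩ := f.2
  refine ⟨⟨fun s => adj (f.1 s), C, fun s => ?_⟩, ?_⟩
  · rw [toOp_adj, ContinuousLinearMap.star_eq_adjoint, LinearIsometryEquiv.norm_map]
    exact hC s
  rw [ContinuousLinearMap.star_eq_adjoint, ContinuousLinearMap.eq_adjoint_iff]
  intro (v : lp (fun _ : G => X.H) 2) (w : lp (fun _ : G => X.H) 2)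
  refine (lp.inner_eq_tsum ..).trans ((tsum_congr fun s => ?_).trans (lp.inner_eq_tsum ..).symm)
  change inner 𝕜 (X.toOp (adj (f.1 s)) (v s)) (w s) = inner 𝕜 (v s) (X.toOp (f.1 s) (w s))
  rw [toOp_adj, ContinuousLinearMap.star_eq_adjoint, ContinuousLinearMap.adjoint_inner_left]

theorem Kind.IsObject.ellInf {k : Kind} (hX : k.IsObject X) : k.IsObject (ellInf G X) := by
  cases k with
  | OSp => trivial
  | OSp1 => exact OperatorSpace.IsUnital.ellInf hX
  | OSy => exact OperatorSpace.IsSystem.ellInf hX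

section Maps

variable {T : Z.V → (ellInf G X).V}

theorem isLinearOver_ellInf_iff : IsLinearOver F₂ T ↔ ∀ s, IsLinearOver F₂ (coord s ∘ T) :=
  ⟨fun h s => (IsLinearOver.of_linearMap (coord s)).comp h,
    fun h => ⟨fun x y => ellInf_ext fun s => (h s).map_add x y,
      fun c x => ellInf_ext fun s => (h s).map_smul c x⟩⟩

theorem mapsUnit_ellInf_iff : MapsUnit T ↔ ∀ s, MapsUnit (coord s ∘ T) :=
  ⟨fun h s z hz => toOp_ellInf_eq_one_iff.mp (h z hz) s,
    fun h z hz => toOp_ellInf_eq_one_iff.mpr fun s => h s z hz⟩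

theorem completelyBoundedBy_ellInf_iff {c : ℝ} (hc : 0 ≤ c) :
    CompletelyBoundedBy T c ↔ ∀ s, CompletelyBoundedBy (coord s ∘ T) c := by
  simp only [CompletelyBoundedBy, matNorm_ellInf_le_iff
    (mul_nonneg hc (OperatorSpace.matNorm_nonneg _)), Matrix.map_map]
  exact ⟨fun h s n a => h n a s, fun h n a s => h s n a⟩

end Maps

/-- The map into `ℓ^∞(G, X)` with coordinates `T s`. -/
def ofFamily {c : ℝ} (T : G → Z.V → X.V) (hT : ∀ s, CompletelyBoundedBy (T s) c) (z : Z.V) :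
    (ellInf G X).V :=
  ⟨fun s => T s z, c * ‖Z.toOp z‖, fun s => (hT s).norm_le z⟩

theorem IsCbInjective.ellInf (hX : IsCbInjective F₂ X) : IsCbInjective F₂ (ellInf G X) := by
  intro A B κ hκ isometric φ hφ c hc bounded
  have exists_extension (s : G) : ∃ ψ : B.V → X.V, IsLinearOver F₂ ψ ∧ CompletelyBoundedBy ψ c ∧
      ∀ a, ψ (κ a) = coord s (φ a) :=
    hX hκ isometric (isLinearOver_ellInf_iff.mp hφ s) hc
      ((completelyBoundedBy_ellInf_iff hc).mp bounded s)
  choose ψ linear bounded_ψ extends_φ using exists_extension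
  exact ⟨ofFamily ψ bounded_ψ, isLinearOver_ellInf_iff.mpr linear,
    (completelyBoundedBy_ellInf_iff hc).mpr bounded_ψ, fun a => ellInf_ext fun s => extends_φ s a⟩

end EllInf

/-! ### Completely bounded norms -/

section CbNorm

variable {𝕜 : Type} [RCLike 𝕜] {F₂ : Type} [RCLike F₂] [NormedAlgebra F₂ 𝕜]
  {X Y Z : OperatorSpace.{u} 𝕜}

theorem OperatorSpace.matNorm_smul {n : ℕ} (r : ℝ) (a : Matrix (Fin n) (Fin n) X.V) :
    X.matNorm (r • a) = |r| * X.matNorm a := by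
  have mat_smul : X.mat (r • a) = (r : 𝕜) • X.mat a := by
    ext v i
    simp [OperatorSpace.mat, matOp_apply, Finset.smul_sum, ← RCLike.real_smul_eq_coe_smul (K := 𝕜),
      LinearMap.map_smul_of_tower]
  rw [OperatorSpace.matNorm, mat_smul, norm_smul, RCLike.norm_ofReal, OperatorSpace.matNorm]

theorem le_cbNorm (T : X.V → Y.V) {n : ℕ} {a : Matrix (Fin n) (Fin n) X.V} (ha : X.matNorm a ≤ 1) :
    ENNReal.ofReal (Y.matNorm (a.map T)) ≤ cbNorm T :=
  le_iSup_of_le n (le_iSup₂_of_le a ha le_rfl)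

theorem CompletelyBoundedBy.cbNorm_le {T : X.V → Y.V} {c : ℝ} (h : CompletelyBoundedBy T c)
    (hc : 0 ≤ c) : cbNorm T ≤ ENNReal.ofReal c :=
  iSup_le fun n => iSup₂_le fun a ha => ENNReal.ofReal_le_ofReal <|
    (h n a).trans (mul_le_of_le_one_right hc ha)

theorem completelyBoundedBy_cbNorm {T : X.V →ₗ[ℝ] Y.V} (hT : cbNorm T ≠ ⊤) :
    CompletelyBoundedBy T (cbNorm T).toReal := fun n a => by
  have bound_of_gt (D : ℝ) (hD : D ∈ Set.Ioi (X.matNorm a)) :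
      Y.matNorm (a.map T) ≤ (cbNorm T).toReal * D := by
    have hD₀ : 0 < D := (OperatorSpace.matNorm_nonneg a).trans_lt hD
    have normalized : X.matNorm (D⁻¹ • a) ≤ 1 := by
      rw [OperatorSpace.matNorm_smul, abs_of_pos (inv_pos.mpr hD₀)]
      exact inv_mul_le_one_of_le₀ (le_of_lt hD) hD₀.le
    have := (ENNReal.ofReal_le_iff_le_toReal hT).mp (le_cbNorm T normalized)
    rwa [Matrix.map_smul T D⁻¹ (T.map_smul D⁻¹), OperatorSpace.matNorm_smul,
      abs_of_pos (inv_pos.mpr hD₀), inv_mul_le_iff₀ hD₀, mul_comm] at this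
  exact ge_of_tendsto (((continuous_const_mul _).tendsto _).mono_left nhdsWithin_le_nhds)
    (Filter.eventually_of_mem self_mem_nhdsWithin bound_of_gt)

namespace CompletelyContractive

variable {T : X.V → Y.V}

theorem cbNorm_le_one (h : CompletelyContractive T) : cbNorm T ≤ 1 :=
  iSup_le fun n => iSup₂_le fun a ha => ENNReal.ofReal_le_one.mpr ((h n a).trans ha)

theorem cbNorm_ne_top (h : CompletelyContractive T) : cbNorm T ≠ ⊤ :=
  ne_top_of_le_ne_top ENNReal.one_ne_top h.cbNorm_le_one

theorem cbNorm_comp_le {S : Y.V → Z.V} (hS : CompletelyContractive S) (T : X.V → Y.V) :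
    cbNorm (S ∘ T) ≤ cbNorm T :=
  iSup_le fun n => iSup₂_le fun a ha => by
    rw [← Matrix.map_map]
    exact (ENNReal.ofReal_le_ofReal (hS n _)).trans (le_cbNorm T ha)

theorem cbNorm_le_of_extension (hT : CompletelyContractive T) {φ : X.V → Z.V} {ψ : Y.V → Z.V}
    (h : ∀ x, ψ (T x) = φ x) : cbNorm φ ≤ cbNorm ψ := by
  obtain rfl : ψ ∘ T = φ := funext h
  exact iSup_le fun n => iSup₂_le fun a ha => by
    rw [← Matrix.map_map]
    exact le_cbNorm ψ ((hT n a).trans ha)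

end CompletelyContractive

theorem IsCbInjective.exists_extension {κ : X.V → Y.V} {φ : X.V → Z.V} (hZ : IsCbInjective F₂ Z)
    (hκ : IsLinearOver F₂ κ) (isometric : CompletelyIsometric κ) (hφ : IsLinearOver F₂ φ)
    (contractive : CompletelyContractive φ) :
    ∃ ψ : Y.V → Z.V, IsLinearOver F₂ ψ ∧ CompletelyContractive ψ ∧ cbNorm ψ ≤ cbNorm φ ∧
      ∀ x, ψ (κ x) = φ x := by
  obtain ⟨ψ, hψ, bounded, extends_φ⟩ := hZ hκ isometric hφ ENNReal.toReal_nonneg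
    (completelyBoundedBy_cbNorm (T := hφ.toRealLinear) contractive.cbNorm_ne_top)
  refine ⟨ψ, hψ, fun n a => (bounded n a).trans ?_, ?_, extends_φ⟩
  · exact mul_le_of_le_one_left (OperatorSpace.matNorm_nonneg a)
      (ENNReal.toReal_mono ENNReal.one_ne_top contractive.cbNorm_le_one)
  · exact (bounded.cbNorm_le ENNReal.toReal_nonneg).trans
      (ENNReal.ofReal_toReal contractive.cbNorm_ne_top).le

end CbNorm

/-! ### Morphisms of the three kinds -/

section Kinds

variable {𝕜 : Type} [RCLike 𝕜] {F₂ : Type} [RCLike F₂] [NormedAlgebra F₂ 𝕜]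
  {X Y Z : OperatorSpace.{u} 𝕜} {k : Kind}

theorem completelyContractive_id : CompletelyContractive (id : X.V → X.V) := fun n a => by
  rw [Matrix.map_id]

theorem mapsUnit_of_extension {κ : X.V → Y.V} {φ : X.V → Z.V} {ψ : Y.V → Z.V} (hX : X.IsUnital)
    (hκ : MapsUnit κ) (hφ : MapsUnit φ) (h : ∀ x, ψ (κ x) = φ x) : MapsUnit ψ := by
  obtain ⟨e, he⟩ := hX
  intro y hy
  have : y = κ e := Y.toOp_injective (by rw [hy, hκ e he])
  rw [this, h]
  exact hφ e he

namespace Kind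

theorem IsObject.isUnital (hX : k.IsObject X) (hk : k ≠ OSp) : X.IsUnital := by
  cases k with
  | OSp => exact absurd rfl hk
  | OSp1 => exact hX
  | OSy => exact hX.1

theorem isObject_fullSpace {H : Type u} [NormedAddCommGroup H] [InnerProductSpace 𝕜 H]
    [CompleteSpace H] : k.IsObject (fullSpace 𝕜 H) := by
  have isUnital : (fullSpace 𝕜 H).IsUnital := ⟨(1 : H →L[𝕜] H), rfl⟩
  cases k with
  | OSp => trivial
  | OSp1 => exact isUnital
  | OSy => exact ⟨isUnital, fun x : H →L[𝕜] H => ⟨(star x : H →L[𝕜] H), rfl⟩⟩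

theorem isMorphism_iff (hX : k.IsObject X) {T : X.V → Y.V} :
    k.IsMorphism F₂ T ↔ IsLinearOver F₂ T ∧ (k ≠ OSp → MapsUnit T) ∧ CompletelyContractive T := by
  cases k with
  | OSp => simp [IsMorphism]
  | OSp1 => simp [IsMorphism]
  | OSy =>
    simp only [IsMorphism, ne_eq, reduceCtorEq, not_false_eq_true, forall_const]
    exact and_congr_right fun hT => and_congr_right fun unit =>
      ⟨CompletelyPositive.completelyContractive (T := hT.toRealLinear) hX unit,
        CompletelyContractive.completelyPositive (T := hT.toRealLinear) hX.1 unit⟩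

theorem isEmbedding_iff {T : X.V → Y.V} :
    k.IsEmbedding F₂ T ↔ IsLinearOver F₂ T ∧ (k ≠ OSp → MapsUnit T) ∧ CompletelyIsometric T := by
  cases k <;> simp [IsEmbedding]

theorem isEmbedding_toOp :
    k.IsEmbedding F₂ (X := X) (Y := fullSpace 𝕜 X.H) X.toOp :=
  isEmbedding_iff.mpr ⟨.of_linearMap (Y := fullSpace 𝕜 X.H) X.toOp, fun _ _ h => h, fun _ _ => rfl⟩

theorem isEmbedding_id : k.IsEmbedding F₂ (id : X.V → X.V) :=
  isEmbedding_iff.mpr ⟨.of_linearMap LinearMap.id, fun _ _ h => h, fun n a => by rw [Matrix.map_id]⟩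

namespace IsMorphism

variable {T : X.V → Y.V}

theorem completelyContractive (hT : k.IsMorphism F₂ T) (hX : k.IsObject X) :
    CompletelyContractive T :=
  ((isMorphism_iff hX).mp hT).2.2

theorem mapsUnit (hT : k.IsMorphism F₂ T) (hk : k ≠ OSp) : MapsUnit T := by
  cases k with
  | OSp => exact absurd rfl hk
  | OSp1 => exact hT.2.1
  | OSy => exact hT.2.1

theorem comp {S : Y.V → Z.V} (hS : k.IsMorphism F₂ S) (hT : k.IsMorphism F₂ T)
    (hX : k.IsObject X) (hY : k.IsObject Y) : k.IsMorphism F₂ (S ∘ T) :=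
  (isMorphism_iff hX).mpr ⟨hS.1.comp hT.1, fun hk x hx => hS.mapsUnit hk _ (hT.mapsUnit hk x hx),
    (hS.completelyContractive hY).comp (hT.completelyContractive hX)⟩

end IsMorphism

namespace IsEmbedding

variable {T : X.V → Y.V}

theorem isMorphism (hT : k.IsEmbedding F₂ T) (hX : k.IsObject X) : k.IsMorphism F₂ T :=
  have ⟨linear, unit, isometric⟩ := isEmbedding_iff.mp hT
  (isMorphism_iff hX).mpr ⟨linear, unit, fun n a => (isometric n a).le⟩

theorem of_comp {S : Y.V → Z.V} (h : k.IsEmbedding F₂ (S ∘ T)) (hS : k.IsMorphism F₂ S)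
    (hT : k.IsMorphism F₂ T) (hX : k.IsObject X) (hY : k.IsObject Y) : k.IsEmbedding F₂ T :=
  isEmbedding_iff.mpr ⟨hT.1, hT.mapsUnit, fun n a =>
    (hT.completelyContractive hX n a).antisymm <| by
      rw [← (isEmbedding_iff.mp h).2.2 n a, ← Matrix.map_map]
      exact hS.completelyContractive hY n _⟩

end IsEmbedding

theorem isMorphism_id (hX : k.IsObject X) : k.IsMorphism F₂ (id : X.V → X.V) :=
  isEmbedding_id.isMorphism hX

theorem isMorphism_ellInf_iff {G : Type u} (hZ : k.IsObject Z) {T : Z.V → (ellInf G X).V} :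
    k.IsMorphism F₂ T ↔ ∀ s, k.IsMorphism F₂ (coord s ∘ T) := by
  simp only [isMorphism_iff hZ, isLinearOver_ellInf_iff (T := T), mapsUnit_ellInf_iff (T := T),
    ← completelyBoundedBy_one_iff, completelyBoundedBy_ellInf_iff (T := T) zero_le_one, forall_and]
  exact and_congr_right' (and_congr_left' forall_comm)

theorem isMorphism_coord {G : Type u} (hX : k.IsObject X) (s : G) :
    k.IsMorphism F₂ (X := ellInf G X) (Y := X) (coord s) :=
  (isMorphism_ellInf_iff hX.ellInf).mp (isMorphism_id hX.ellInf) s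

theorem isInjective_of_retract {i : X.V → Y.V} {r : Y.V → X.V} (hX : k.IsObject X)
    (hY : k.IsObject Y) (injective : IsCbInjective F₂ Y) (hi : k.IsMorphism F₂ i)
    (hr : k.IsMorphism F₂ r) (hri : ∀ x, r (i x) = x) : IsInjective k F₂ X := by
  intro A B hA hB κ hκ φ hφ
  obtain ⟨hκ_linear, hκ_unit, isometric⟩ := isEmbedding_iff.mp hκ
  obtain ⟨ψ, hψ, contractive, cbNorm_ψ_le, extends_iφ⟩ := injective.exists_extension hκ_linear
    isometric (hi.1.comp hφ.1) ((hi.comp hφ hA hX).completelyContractive hA)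
  have r_contractive := hr.completelyContractive hY
  have extends_φ (a : A.V) : (r ∘ ψ) (κ a) = φ a := by
    simp only [Function.comp_apply, extends_iφ, hri]
  refine ⟨r ∘ ψ, (isMorphism_iff hB).mpr ⟨hr.1.comp hψ, fun hk => ?_,
    r_contractive.comp contractive⟩, extends_φ, le_antisymm ?_ ?_⟩
  · exact mapsUnit_of_extension (hA.isUnital hk) (hκ_unit hk) (hφ.mapsUnit hk) extends_φ
  · calc cbNorm (r ∘ ψ)
      _ ≤ cbNorm ψ := r_contractive.cbNorm_comp_le ψ
      _ ≤ cbNorm (i ∘ φ) := cbNorm_ψ_le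
      _ ≤ cbNorm φ := (hi.completelyContractive hX).cbNorm_comp_le φ
  · exact ((hκ.isMorphism hA).completelyContractive hA).cbNorm_le_of_extension extends_φ

end Kind

end Kinds

/-! ### Equivariant maps into `ℓ^∞(G, Y)` -/

section Orbit

variable {𝕜 : Type} [RCLike 𝕜] {F₂ : Type} [RCLike F₂] [NormedAlgebra F₂ 𝕜] {k : Kind}
  {G : Type u} {X Y Z : OperatorSpace.{u} 𝕜}

theorem cbNorm_ellInf_le {T : Z.V → (ellInf G Y).V} {c : ENNReal}
    (h : ∀ s, cbNorm (coord s ∘ T) ≤ c) : cbNorm T ≤ c := by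
  obtain rfl | hc := eq_or_ne c ⊤
  · exact le_top
  refine iSup_le fun n => iSup₂_le fun a ha => (ENNReal.ofReal_le_iff_le_toReal hc).mpr ?_
  refine (matNorm_ellInf_le_iff ENNReal.toReal_nonneg).mpr fun s => ?_
  rw [Matrix.map_map]
  exact (ENNReal.ofReal_le_iff_le_toReal hc).mp ((le_cbNorm _ ha).trans (h s))

variable [Group G]

theorem Kind.IsActionMap.isMorphism {T : X.V →ₗ[𝕜] X.V} (hT : k.IsActionMap T) :
    k.IsMorphism F₂ T := by
  refine ⟨.of_linearMap T, ?_⟩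
  cases k with
  | OSp => exact fun n a => (hT n a).le
  | OSp1 => exact ⟨hT.1, fun n a => (hT.2 n a).le⟩
  | OSy => exact ⟨hT.1, fun n a => (hT.2 n a).mp⟩

theorem map_map_representation_inv (ρ : Representation 𝕜 G X.V) (g : G) {n : ℕ}
    (a : Matrix (Fin n) (Fin n) X.V) : (a.map (ρ g)).map (ρ g⁻¹) = a := by
  ext i j
  exact ρ.inv_self_apply g (a i j)

theorem Kind.isActionMap_of_isMorphism {ρ : Representation 𝕜 G X.V}
    (h : ∀ g, k.IsMorphism 𝕜 (ρ g)) (g : G) : k.IsActionMap (ρ g) := by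
  have isometric (hρ : ∀ g, CompletelyContractive (ρ g)) : CompletelyIsometric (ρ g) :=
    fun n a => (hρ g n a).antisymm <| by
      simpa only [map_map_representation_inv] using hρ g⁻¹ n (a.map (ρ g))
  cases k with
  | OSp => exact isometric fun g => (h g).2
  | OSp1 => exact ⟨(h g).2.1, isometric fun g => (h g).2.2⟩
  | OSy => exact ⟨(h g).2.1, fun n a => ⟨(h g).2.2 n a, fun ha => by
      simpa only [map_map_representation_inv] using (h g⁻¹).2.2 n _ ha⟩⟩

theorem Kind.isMorphism_translation (hY : k.IsObject Y) (g : G) :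
    k.IsMorphism F₂ (translation G Y g) :=
  (isMorphism_ellInf_iff hY.ellInf).mpr fun s => isMorphism_coord hY (g⁻¹ * s)

/-- The object `ℓ^∞(G, Y)` of the `G`-category, on which `G` acts by translation. -/
def ellInfObject (G : Type u) [Group G] (hY : k.IsObject Y) : GObject k 𝕜 G where
  space := ellInf G Y
  isObject := hY.ellInf
  act := translation G Y
  isActionMap := Kind.isActionMap_of_isMorphism (Kind.isMorphism_translation hY)

variable {B : GObject k 𝕜 G}

theorem GObject.completelyContractive_act (B : GObject k 𝕜 G) (g : G) :
    CompletelyContractive (B.act g) :=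
  (B.isActionMap g).isMorphism (F₂ := 𝕜) |>.completelyContractive B.isObject

/-- The equivariant map `b ↦ (s ↦ T (s⁻¹ b))` into `ℓ^∞(G, Y)` induced by a complete contraction
`T`; the embedding `j` is the case `T = id`. -/
def orbitMap (T : B.space.V → Y.V) (hT : CompletelyContractive T) :
    B.space.V → (ellInf G Y).V :=
  ofFamily (fun s => T ∘ B.act s⁻¹) fun s =>
    completelyBoundedBy_one_iff.mpr (hT.comp (B.completelyContractive_act s⁻¹))

variable {T : B.space.V → Y.V} (hT : CompletelyContractive T)

theorem coord_comp_orbitMap (s : G) : coord s ∘ orbitMap T hT = T ∘ B.act s⁻¹ := rfl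

theorem coord_one_comp_orbitMap : coord 1 ∘ orbitMap T hT = T := by
  rw [coord_comp_orbitMap, inv_one, map_one]
  rfl

theorem isEquivariant_orbitMap : IsEquivariant B.act (translation G Y) (orbitMap T hT) :=
  fun g b => ellInf_ext fun s => congrArg T <| by
    rw [mul_inv_rev, inv_inv, map_mul]
    rfl

theorem cbNorm_orbitMap_le : cbNorm (orbitMap T hT) ≤ cbNorm T :=
  cbNorm_ellInf_le fun s => (B.completelyContractive_act s⁻¹).cbNorm_le_of_extension fun _ => rfl

theorem isMorphism_orbitMap (h : k.IsMorphism F₂ T) : k.IsMorphism F₂ (orbitMap T hT) :=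
  (Kind.isMorphism_ellInf_iff B.isObject).mpr fun s =>
    h.comp (B.isActionMap s⁻¹).isMorphism B.isObject B.isObject

theorem isEmbedding_orbitMap (hY : k.IsObject Y) (h : k.IsEmbedding F₂ T) :
    k.IsEmbedding F₂ (orbitMap T hT) :=
  .of_comp (by rwa [coord_one_comp_orbitMap]) (Kind.isMorphism_coord hY 1)
    (isMorphism_orbitMap hT (h.isMorphism B.isObject)) B.isObject hY.ellInf

end Orbit

/-! ### Injectivity of `G`-objects -/

section GInjective

variable {𝕜 : Type} [RCLike 𝕜] {F₂ : Type} [RCLike F₂] [NormedAlgebra F₂ 𝕜] {k : Kind}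
  {G : Type u} [Group G] {X : GObject k 𝕜 G}

theorem GObject.coord_one_j (x : X.space.V) : coord 1 (X.j x) = x :=
  congrFun (coord_one_comp_orbitMap completelyContractive_id) x

theorem GObject.isMorphism_j : k.IsMorphism F₂ X.j :=
  isMorphism_orbitMap completelyContractive_id (Kind.isMorphism_id X.isObject)

theorem GObject.isEquivariant_j : IsEquivariant X.act (translation G X.space) X.j :=
  isEquivariant_orbitMap completelyContractive_id

/-- An equivariant morphism `ℓ^∞(G, X) → X` that is a left inverse of the embedding `j`. -/
structure IsEquivariantRetraction (F₂ : Type) [RCLike F₂] [NormedAlgebra F₂ 𝕜]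
    (X : GObject k 𝕜 G) (r : (ellInf G X.space).V → X.space.V) : Prop where
  isMorphism : k.IsMorphism F₂ r
  isEquivariant : IsEquivariant (translation G X.space) X.act r
  apply_j : ∀ x, r (X.j x) = x

theorem exists_isEquivariantRetraction_iff :
    (∃ r, IsEquivariantRetraction F₂ X r) ↔
      ∃ φ : (ellInf G X.space).V → (ellInf G X.space).V, k.IsMorphism F₂ φ ∧
        IsEquivariant (translation G X.space) (translation G X.space) φ ∧
        (∀ f, φ (φ f) = φ f) ∧ Set.range φ = Set.range X.j ∧ ∀ x, φ (X.j x) = X.j x := by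
  constructor
  · rintro ⟨r, hr⟩
    refine ⟨X.j ∘ r, GObject.isMorphism_j.comp hr.isMorphism X.isObject.ellInf X.isObject,
      fun g f => ?_, fun f => ?_, (Set.range_comp_subset_range r X.j).antisymm ?_, fun x => ?_⟩
    · simp only [Function.comp_apply, hr.isEquivariant g f, GObject.isEquivariant_j g (r f)]
    · simp only [Function.comp_apply, hr.apply_j]
    · rintro _ ⟨x, rfl⟩
      exact ⟨X.j x, congrArg X.j (hr.apply_j x)⟩
    · exact congrArg X.j (hr.apply_j x)
  · rintro ⟨φ, morphism, equivariant, -, range_eq, fix⟩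
    have j_coord_one (f) : X.j (coord 1 (φ f)) = φ f := by
      obtain ⟨x, hx⟩ := range_eq ▸ Set.mem_range_self f
      rw [← hx, GObject.coord_one_j]
    refine ⟨coord 1 ∘ φ, (Kind.isMorphism_coord X.isObject 1).comp morphism X.isObject.ellInf
      X.isObject.ellInf, fun g f => ?_, fun x => ?_⟩
    · rw [Function.comp_apply, equivariant, ← j_coord_one, ← GObject.isEquivariant_j,
        GObject.coord_one_j, Function.comp_apply]
    · rw [Function.comp_apply, fix, GObject.coord_one_j]

namespace IsGInjective

theorem exists_retraction (hX : IsGInjective F₂ X) {Y : OperatorSpace.{u} 𝕜} (hY : k.IsObject Y)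
    {T : X.space.V → Y.V} (hT : k.IsEmbedding F₂ T) (contractive : CompletelyContractive T) :
    ∃ r : (ellInf G Y).V → X.space.V, k.IsMorphism F₂ r ∧
      IsEquivariant (translation G Y) X.act r ∧ ∀ x, r (orbitMap T contractive x) = x := by
  obtain ⟨r, morphism, equivariant, retraction, -⟩ := hX X (ellInfObject G hY)
    (orbitMap T contractive) (isEmbedding_orbitMap contractive hY hT)
    (isEquivariant_orbitMap contractive) id (Kind.isMorphism_id X.isObject) fun _ _ => rfl
  exact ⟨r, morphism, equivariant, retraction⟩

theorem exists_isEquivariantRetraction (hX : IsGInjective F₂ X) :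
    ∃ r, IsEquivariantRetraction F₂ X r :=
  have ⟨r, morphism, equivariant, retraction⟩ :=
    hX.exists_retraction X.isObject Kind.isEmbedding_id completelyContractive_id
  ⟨r, morphism, equivariant, retraction⟩

theorem isInjective (hX : IsGInjective F₂ X) : IsInjective k F₂ X.space := by
  have isMorphism_toOp : k.IsMorphism F₂ (Y := fullSpace 𝕜 X.space.H) X.space.toOp :=
    Kind.isEmbedding_toOp.isMorphism X.isObject
  obtain ⟨r, morphism, -, retraction⟩ := hX.exists_retraction Kind.isObject_fullSpace
    Kind.isEmbedding_toOp (isMorphism_toOp.completelyContractive X.isObject)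
  exact Kind.isInjective_of_retract X.isObject Kind.isObject_fullSpace.ellInf
    isCbInjective_fullSpace.ellInf (isMorphism_orbitMap _ isMorphism_toOp) morphism retraction

end IsGInjective

theorem IsEquivariantRetraction.isGInjective {r : (ellInf G X.space).V → X.space.V}
    (hr : IsEquivariantRetraction F₂ X r) (hX : IsInjective k F₂ X.space) : IsGInjective F₂ X := by
  intro A B κ hκ κ_equivariant φ hφ φ_equivariant
  obtain ⟨ψ, hψ, ψ_extends, cbNorm_ψ⟩ :=
    hX A.space B.space A.isObject B.isObject κ hκ φ hφ
  have ψ_contractive := hψ.completelyContractive B.isObject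
  have orbitMap_extends (a : A.space.V) : orbitMap ψ ψ_contractive (κ a) = X.j (φ a) :=
    ellInf_ext fun s => calc ψ (B.act s⁻¹ (κ a))
      _ = ψ (κ (A.act s⁻¹ a)) := by rw [κ_equivariant]
      _ = φ (A.act s⁻¹ a) := ψ_extends _
      _ = X.act s⁻¹ (φ a) := φ_equivariant s⁻¹ a
  have r_extends (a : A.space.V) : (r ∘ orbitMap ψ ψ_contractive) (κ a) = φ a := by
    rw [Function.comp_apply, orbitMap_extends, hr.apply_j]
  refine ⟨r ∘ orbitMap ψ ψ_contractive, hr.isMorphism.comp (isMorphism_orbitMap _ hψ) B.isObject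
    X.isObject.ellInf, fun g b => ?_, r_extends, le_antisymm ?_ ?_⟩
  · simp only [Function.comp_apply, isEquivariant_orbitMap ψ_contractive g b,
      hr.isEquivariant g]
  · calc cbNorm (r ∘ orbitMap ψ ψ_contractive)
      _ ≤ cbNorm (orbitMap ψ ψ_contractive) :=
        (hr.isMorphism.completelyContractive X.isObject.ellInf).cbNorm_comp_le _
      _ ≤ cbNorm ψ := cbNorm_orbitMap_le ψ_contractive
      _ = cbNorm φ := cbNorm_ψ
  · exact ((hκ.isMorphism A.isObject).completelyContractive A.isObject).cbNorm_le_of_extension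
      r_extends

theorem isGInjective_iff :
    IsGInjective F₂ X ↔ IsInjective k F₂ X.space ∧ ∃ r, IsEquivariantRetraction F₂ X r :=
  ⟨fun h => ⟨h.isInjective, h.exists_isEquivariantRetraction⟩,
    fun ⟨injective, _, hr⟩ => hr.isGInjective injective⟩

end GInjective

end OpSp

end

theorem mainTheorem6 {F₁ F₂ : Type} [RCLike F₁] [RCLike F₂] [NormedAlgebra F₂ F₁]
    {G : Type*} [Group G] (k : OpSp.Kind) (X : OpSp.GObject k F₁ G) :
    OpSp.IsGInjective F₂ X ↔
      OpSp.IsInjective k F₂ X.space ∧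
      ∃ φ : (OpSp.ellInf G X.space).V → (OpSp.ellInf G X.space).V,
        k.IsMorphism F₂ φ ∧
        OpSp.IsEquivariant (OpSp.translation G X.space) (OpSp.translation G X.space) φ ∧
        (∀ f, φ (φ f) = φ f) ∧
        Set.range φ = Set.range X.j ∧
        ∀ x, φ (X.j x) = X.j x := by
  rw [OpSp.isGInjective_iff, OpSp.exists_isEquivariantRetraction_iff]
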